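/- Let $p$ be a prime. A regular local ring $(T,\mathfrak m,K)$ is called unramified of mixed characteristic $(0,p)$ if $\operatorname{char}T=0$, $\operatorname{char}K=p$ and $p\notin\mathfrak m^2$. For a Noetherian local ring $(R,\mathfrak m_R,K)$ with $\operatorname{char}K=p$, completion $\widehat R$, and $i,j\in\mathbb N$, the Lyubeznik number in mixed characteristic of $R$ is $$\widetilde\lambda_{i,j}(R)=\dim_K\operatorname{Ext}^i_T\bigl(K,H^{d-j}_I(T)\bigr),$$ where $T$ is any unramified regular local ring of mixed characteristic $(0,p)$ with a surjective ring homomorphism $\pi:T\twoheadrightarrow\widehat R$, $d=\dim T$, $I=\ker\pi$, and local cohomology in negative degrees is zero (such a $\pi$ exists, and the number does not depend on its choice). Let $V$ be a complete discrete valuation ring of characteristic zero with maximal ideal $pV$, let $S=V[[x_1,\ldots,x_n]]$ with $n\ge 0$, and let $f_1,\ldots,f_\ell\in S$ ($\ell\ge 0$) be a regular sequence (in particular $(f_1,\ldots,f_\ell)\ne S$). Then, for all $i,j\in\mathbb N$, $$\widetilde\lambda_{i,j}\bigl(S/(f_1,\ldots,f_\ell)\bigr)=\begin{cases}1&\text{if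 } i=j=n+1-\ell,\\ 0&\text{otherwise.}\end{cases}$$ -/

import Mathlib

open CategoryTheory IsLocalRing

universe u

section ExtResidueField

variable (T : Type u) [CommRing T] [IsLocalRing T]

/-- `Ext^i_T(K, M)`, where `K` is the residue field of the local ring `T`. -/
abbrev ExtResidue (M : ModuleCat.{u} T) (i : ℕ) : Type u :=
  Abelian.Ext.{u} (ModuleCat.of T (ResidueField T)) M i

/-- The maximal ideal of `T` annihilates `Ext^i_T(K, M)`. -/
theorem extResidue_isTorsionBySet (M : ModuleCat.{u} T) (i : ℕ) :
    Module.IsTorsionBySet T (ExtResidue T M i) (maximalIdeal T : Set T) := by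
  rintro e ⟨a, ha⟩
  have h0 : a • 𝟙 (ModuleCat.of T (ResidueField T)) = 0 := by
    ext x
    obtain ⟨y, rfl⟩ := residue_surjective (R := T) x
    have h : a • residue T y = 0 := by
      rw [Algebra.smul_def, ResidueField.algebraMap_eq, (residue_eq_zero_iff a).2 ha, zero_mul]
    simpa using h
  have h1 : a • e = (Abelian.Ext.mk₀ (a • 𝟙 (ModuleCat.of T (ResidueField T)))).comp e
      (zero_add i) := by
    simp [Abelian.Ext.mk₀_smul]
  change a • e = 0
  rw [h1, h0]
  simp

/-- The `K`-vector space structure on `Ext^i_T(K, M)` induced by its `T`-module structure. -/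
noncomputable instance extResidueModule (M : ModuleCat.{u} T) (i : ℕ) :
    Module (ResidueField T) (ExtResidue T M i) :=
  letI : Module (T ⧸ maximalIdeal T) (ExtResidue T M i) :=
    (extResidue_isTorsionBySet T M i).module
  inferInstanceAs (Module (T ⧸ maximalIdeal T) (ExtResidue T M i))

/-- The two structures agree: the class of `a` in `K` acts as `a` does. -/
theorem residue_smul_extResidue (M : ModuleCat.{u} T) (i : ℕ) (a : T) (e : ExtResidue T M i) :
    residue T a • e = a • e := rfl

/-- `dim_K Ext^i_T(K, H^{d-j}_I(T))`, as a cardinal, for an ideal `I` of a local ring `T` with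
residue field `K`; here `d` is to be the dimension of `T`. Local cohomology in a negative degree
`d - j` is zero. -/
noncomputable def extLocalCohomologyDim (I : Ideal T) (d i j : ℕ) : Cardinal.{u} :=
  if j ≤ d then
    Module.rank (ResidueField T)
      (ExtResidue T ((localCohomology I (d - j)).obj (ModuleCat.of T T)) i)
  else 0

end ExtResidueField

/-- `T` is an unramified regular local ring of mixed characteristic `(0, p)`: it is regular local
of characteristic zero, its residue field has characteristic `p > 0`, and `p ∉ m²`. -/
structure IsUnramifiedRegularLocalRing (p : ℕ) (T : Type u) [CommRing T] [IsLocalRing T] :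
    Prop where
  regular : IsRegularLocalRing T
  prime : p.Prime
  charZero : CharZero T
  residueChar : CharP (ResidueField T) p
  natCast_notMem_sq : (p : T) ∉ maximalIdeal T ^ 2

/-- A presentation of the completion of the local ring `R`: an unramified regular local ring `T`
of mixed characteristic `(0, p)`, of dimension `dim`, with a surjection `π` of `T` onto the
completion of `R` at its maximal ideal. -/
structure UnramifiedPresentation (p : ℕ) (R : Type u) [CommRing R] [IsLocalRing R] where
  T : Type u
  [commRing : CommRing T]
  [isLocalRing : IsLocalRing T]
  unramified : IsUnramifiedRegularLocalRing p T
  dim : ℕ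
  ringKrullDim_eq : ringKrullDim T = dim
  π : T →+* AdicCompletion (maximalIdeal R) R
  surjective : Function.Surjective π

attribute [instance] UnramifiedPresentation.commRing UnramifiedPresentation.isLocalRing

/-- The number `dim_K Ext^i_T(K, H^{dim T - j}_I(T))`, `I = ker π`, computed from a presentation. -/
noncomputable def UnramifiedPresentation.number {p : ℕ} {R : Type u} [CommRing R] [IsLocalRing R]
    (P : UnramifiedPresentation p R) (i j : ℕ) : Cardinal.{u} :=
  extLocalCohomologyDim P.T (RingHom.ker P.π) P.dim i j

/-- The mixed characteristic Lyubeznik number of the local ring `R` with indices `i`, `j` is `c`: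
the completion of `R` has a presentation by an unramified regular local ring of mixed
characteristic `(0, p)`, and `dim_K Ext^i_T(K, H^{dim T - j}_I(T)) = c` for every such
presentation, so that the number is well defined. -/
def HasLyubeznikNumber (p : ℕ) (R : Type u) [CommRing R] [IsLocalRing R] (i j : ℕ)
    (c : Cardinal.{u}) : Prop :=
  Nonempty (UnramifiedPresentation p R) ∧
    ∀ P : UnramifiedPresentation p R, P.number i j = c

/-- The quotient of a local ring by a regular sequence is a local ring. -/
theorem isLocalRing_quotient_of_isRegular {S : Type u} [CommRing S] [IsLocalRing S] {l : ℕ}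
    {f : Fin l → S} (hf : RingTheory.Sequence.IsRegular S (List.ofFn f)) :
    IsLocalRing (S ⧸ Ideal.span (Set.range f)) := by
  have hne : Ideal.span (Set.range f) ≠ ⊤ := by
    intro h
    apply hf.top_ne_smul
    have : Ideal.ofList (List.ofFn f) = Ideal.span (Set.range f) := by
      simp only [Ideal.ofList, List.mem_ofFn]
      rfl
    rw [this, h]
    simp
  have : Nontrivial (S ⧸ Ideal.span (Set.range f)) := Ideal.Quotient.nontrivial_iff.2 hne
  exact IsLocalRing.of_surjective' (Ideal.Quotient.mk _) Ideal.Quotient.mk_surjective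

/-! The ring `R = S/(f)` is already complete, so a presentation amounts to a surjection of some `T`
onto `R`, with kernel `I`. The heart of the matter is that `I` is generated by a regular sequence
for every such `T`. Take a regular sequence generating the maximal ideal of `T`: the first Koszul
homology of its image in `R` is `I/mI` (`length_koszulH1_eq_spanFinrank_ker`), and adjoining `b`
redundant elements to a generating list of the maximal ideal of `R` adds `b` to the length of this
homology (`length_koszulH1_coprod`). Hence `μ(I) - dim T`, with `μ` the minimal number of
generators, does not depend on the presentation. Comparing with `S` gives `μ(I) = dim T - dim R`,
and since `T` is Cohen–Macaulay, a minimal generating list of `I` is a regular sequence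
(`isWeaklyRegular_of_supportDim_le`, `exists_isRegular_ofList_eq_ker`).

Let `c` be the length of this sequence. Then `H^k_I(T) = 0` for `k ≠ c`, and `N = H^c_I(T)`
satisfies `Ext^i(X, N) ≅ Ext^{i+c}(X, T)` for every `X` killed by powers of the generators
(`exists_ext_shift`, `nonempty_localCohomology_length_linearEquiv`). For `X = K` the right side is
`K` if `i + c = dim T` and zero otherwise, because `K` is the quotient of `T` by a regular sequence
of length `dim T` (`extSelfConcentrated_quotient_ofList`). So the number is `1` exactly when `dim T
- j = c` and `i + c = dim T`, that is `i = j = dim T - c = n + 1 - l`. -/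

section
-- Comparison of `Ext` as a derived functor, used in `localCohomology`, with `Abelian.Ext`.
open CategoryTheory.Abelian Limits Opposite

variable {R : Type u} [CommRing R]

namespace CategoryTheory.ProjectiveResolution
variable {X Y : ModuleCat.{u} R} (P : ProjectiveResolution X)

lemma smul_extMk {n : ℕ} (r : R) (f : P.complex.X n ⟶ Y) (m : ℕ) (hm : n + 1 = m)
    (hf : P.complex.d m n ≫ f = 0) :
    P.extMk (r • f) m hm (by simp [hf]) = r • P.extMk f m hm hf := by
  rw [Abelian.Ext.smul_eq_comp_mk₀, extMk_comp_mk₀]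
  congr 1

/-- In degree zero there are no coboundaries, since the resolution has no term on the other side.
`extMk_eq_zero_iff` needs such a preceding term, so this case stands apart. -/
lemma extMk_zero_eq_zero_iff (f : P.complex.X 0 ⟶ Y) (hf : P.complex.d 1 0 ≫ f = 0) :
    P.extMk f 1 rfl hf = 0 ↔ f = 0 := by
  refine ⟨fun h => ?_, fun h => by subst h; simp⟩
  rw [← P.extEquivCohomologyClass.apply_eq_iff_eq, extEquivCohomologyClass_extMk,
    extEquivCohomologyClass_zero, CochainComplex.HomComplex.CohomologyClass.mk_eq_zero_iff,
    CochainComplex.HomComplex.Cocycle.toSingleMk_mem_coboundaries_iff _ _ _ _ _ 1 (by lia)] at h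
  obtain ⟨g, hg⟩ := h
  have hz : g = 0 := (P.cochainComplex.isZero_of_isStrictlyLE 0 1 (by simp)).eq_of_src _ _
  rw [hz, comp_zero] at hg
  rw [← cancel_epi (P.cochainComplexXIso (-(0 : ℕ)) 0 rfl).hom, ← hg, comp_zero]

/-- The cochain complex of morphisms from a projective resolution into `Y`. -/
noncomputable abbrev homComplex (Y : ModuleCat.{u} R) : CochainComplex (ModuleCat.{u} R) ℕ :=
  P.complex.linearYonedaObj R Y

/-- A cocycle of the complex of morphisms, as a morphism into `Y`. -/
noncomputable def cocycleHom {n : ℕ} (z : (P.homComplex Y).cycles n) : P.complex.X n ⟶ Y :=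
  (P.homComplex Y).iCycles n z

lemma d_comp_cocycleHom {n : ℕ} (z : (P.homComplex Y).cycles n) (m : ℕ) :
    P.complex.d m n ≫ P.cocycleHom z = 0 := by
  change (P.homComplex Y).d n m ((P.homComplex Y).iCycles n z) = 0
  rw [← ConcreteCategory.comp_apply, HomologicalComplex.iCycles_d]
  rfl

/-- The class in `Ext` of a cocycle of the complex of morphisms. -/
noncomputable def cyclesToExt (Y : ModuleCat.{u} R) (n : ℕ) :
    (P.homComplex Y).cycles n ⟶ ModuleCat.of R (Abelian.Ext.{u} X Y n) :=
  ModuleCat.ofHom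
    { toFun z := P.extMk (P.cocycleHom z) (n + 1) rfl (P.d_comp_cocycleHom z _)
      map_add' z w := by
        rw [add_extMk]
        congr 1
        exact map_add ((P.homComplex Y).iCycles n).hom z w
      map_smul' r z := by
        rw [RingHom.id_apply, ← smul_extMk]
        congr 1
        exact map_smul ((P.homComplex Y).iCycles n).hom r z }

lemma toCycles_cyclesToExt (Y : ModuleCat.{u} R) (n p : ℕ) :
    (P.homComplex Y).toCycles p n ≫ P.cyclesToExt Y n = 0 := by
  by_cases hp : p + 1 = n
  · ext g
    refine (P.extMk_eq_zero_iff (P.cocycleHom ((P.homComplex Y).toCycles p n g)) (n + 1) rfl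
      (P.d_comp_cocycleHom _ _) p hp).2 ⟨g, ?_⟩
    exact (ConcreteCategory.congr_hom ((P.homComplex Y).toCycles_i p n) g).symm
  · rw [HomologicalComplex.toCycles_eq_zero, zero_comp]
    simpa using hp

/-- The comparison of the cohomology of the complex of morphisms with `Ext`. -/
noncomputable def homologyToExt (Y : ModuleCat.{u} R) (n : ℕ) :
    (P.homComplex Y).homology n ⟶ ModuleCat.of R (Abelian.Ext.{u} X Y n) :=
  ((P.homComplex Y).homologyIsCokernel _ n rfl).desc
    (CokernelCofork.ofπ (P.cyclesToExt Y n) (P.toCycles_cyclesToExt Y n _))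

lemma homologyπ_homologyToExt (Y : ModuleCat.{u} R) (n : ℕ) :
    (P.homComplex Y).homologyπ n ≫ P.homologyToExt Y n = P.cyclesToExt Y n :=
  ((P.homComplex Y).homologyIsCokernel _ n rfl).fac _ WalkingParallelPair.one

lemma homologyToExt_homologyπ (Y : ModuleCat.{u} R) (n : ℕ) (z : (P.homComplex Y).cycles n) :
    P.homologyToExt Y n ((P.homComplex Y).homologyπ n z) =
      P.extMk (P.cocycleHom z) (n + 1) rfl (P.d_comp_cocycleHom z _) :=
  ConcreteCategory.congr_hom (P.homologyπ_homologyToExt Y n) z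

/-- A cocycle has zero class in `Ext` exactly when it is a coboundary, and every class comes from a
cocycle. -/
lemma homologyToExt_bijective (Y : ModuleCat.{u} R) (n : ℕ) :
    Function.Bijective (P.homologyToExt Y n) := by
  have hπ : Function.Surjective ((P.homComplex Y).homologyπ n) :=
    (ModuleCat.epi_iff_surjective _).1 inferInstance
  have hi : Function.Injective ((P.homComplex Y).iCycles n) :=
    (ModuleCat.mono_iff_injective _).1 inferInstance
  constructor
  · refine (injective_iff_map_eq_zero (P.homologyToExt Y n).hom).2 fun x hx => ?_
    obtain ⟨z, rfl⟩ := hπ x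
    have hz := (P.homologyToExt_homologyπ Y n z).symm.trans hx
    cases n with
    | zero =>
      have h0 : P.cocycleHom z = 0 := (P.extMk_zero_eq_zero_iff _ _).1 hz
      have : z = 0 := hi (h0.trans (map_zero ((P.homComplex Y).iCycles 0).hom).symm)
      rw [this]
      exact map_zero ((P.homComplex Y).homologyπ 0).hom
    | succ p =>
      obtain ⟨g, hg⟩ := (P.extMk_eq_zero_iff _ _ _ _ p rfl).1 hz
      have : z = (P.homComplex Y).toCycles p (p + 1) g := hi
        (hg.symm.trans (ConcreteCategory.congr_hom ((P.homComplex Y).toCycles_i p _) g).symm)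
      rw [this]
      change ((P.homComplex Y).toCycles p (p + 1) ≫ (P.homComplex Y).homologyπ (p + 1)) g = 0
      rw [HomologicalComplex.toCycles_comp_homologyπ]
      rfl
  · intro e
    obtain ⟨f, hf, rfl⟩ := P.extMk_surjective e (n + 1) rfl
    -- The element `f` is encoded as a morphism out of `R`, so that the universal property of cycles
    -- applies to it.
    have hk : ModuleCat.ofHom (LinearMap.toSpanSingleton R ((P.homComplex Y).X n) f) ≫
        (P.homComplex Y).d n (n + 1) = 0 := by
      ext
      change (P.homComplex Y).d n (n + 1) ((1 : R) • f) = 0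
      rw [one_smul]
      exact hf
    let s := (P.homComplex Y).liftCycles _ (n + 1) (by simp) hk
    refine ⟨(P.homComplex Y).homologyπ n (s (1 : R)), ?_⟩
    rw [homologyToExt_homologyπ]
    congr 1
    change (s ≫ (P.homComplex Y).iCycles n) (1 : R) = f
    rw [HomologicalComplex.liftCycles_i]
    exact one_smul R f

/-- Precomposition with a chain map lifting a morphism. -/
noncomputable def homComplexMap {X' : ModuleCat.{u} R} {P' : ProjectiveResolution X'}
    {P : ProjectiveResolution X} (φ : P'.complex ⟶ P.complex) (Y : ModuleCat.{u} R) :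
    P.homComplex Y ⟶ P'.homComplex Y :=
  (HomologicalComplex.unopFunctor _ _).map
    ((((linearYoneda R (ModuleCat.{u} R)).obj Y).rightOp.mapHomologicalComplex _).map φ).op

lemma homologyMap_homologyToExt {X' : ModuleCat.{u} R} {P' : ProjectiveResolution X'}
    {P : ProjectiveResolution X} {g : X' ⟶ X} (φ : Hom P' P g) (Y : ModuleCat.{u} R) (n : ℕ)
    (x : (P.homComplex Y).homology n) :
    P'.homologyToExt Y n (HomologicalComplex.homologyMap (homComplexMap φ.hom Y) n x) =
      (Abelian.Ext.mk₀ g).comp (P.homologyToExt Y n x) (zero_add n) := by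
  have hπ : Function.Surjective ((P.homComplex Y).homologyπ n) :=
    (ModuleCat.epi_iff_surjective _).1 inferInstance
  obtain ⟨z, rfl⟩ := hπ x
  have h1 := ConcreteCategory.congr_hom
    (HomologicalComplex.homologyπ_naturality (homComplexMap φ.hom Y) n) z
  have h2 := ConcreteCategory.congr_hom
    (HomologicalComplex.cyclesMap_i (homComplexMap φ.hom Y) n) z
  rw [homologyToExt_homologyπ, mk₀_comp_extMk _ _ _ _ φ]
  refine (congrArg (P'.homologyToExt Y n) h1).trans ?_
  refine (P'.homologyToExt_homologyπ Y n _).trans ?_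
  congr 1

end CategoryTheory.ProjectiveResolution

/-- The formal part of `isoExt_naturality`, isolated in an arbitrary category to keep derived
functors out of the rewriting. -/
lemma unop_conj_comp_eq {C : Type*} [Category* C] {A A' B B' : Cᵒᵖ} {D D' : C} (a : A ≅ A')
    (c : B ≅ B') (u : A' ⟶ B') (d : op D ≅ A') (e : op D' ≅ B') (m : D' ⟶ D)
    (h : u ≫ e.inv = d.inv ≫ m.op) :
    (a.hom ≫ u ≫ c.inv).unop ≫ a.inv.unop ≫ d.hom.unop =
      (c.inv.unop ≫ e.hom.unop) ≫ m := by
  have h' : d.hom ≫ u = m.op ≫ e.hom := by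
    rw [← cancel_mono e.inv, Category.assoc, h]
    simp
  apply Quiver.Hom.op_inj
  simp only [op_comp, Quiver.Hom.op_unop, Category.assoc, Iso.inv_hom_id_assoc]
  rw [reassoc_of% h']

lemma isoExt_naturality {X' X : ModuleCat.{u} R} {P' : ProjectiveResolution X'}
    {P : ProjectiveResolution X} {g : X' ⟶ X} (φ : ProjectiveResolution.Hom P' P g)
    (Y : ModuleCat.{u} R) (n : ℕ) :
    ((Ext R (ModuleCat.{u} R) n).map g.op).app Y ≫ (P'.isoExt n Y).hom =
      (P.isoExt n Y).hom ≫
        HomologicalComplex.homologyMap (ProjectiveResolution.homComplexMap φ.hom Y) n := by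
  have h1 := ((linearYoneda R (ModuleCat.{u} R)).obj Y).rightOp.leftDerived_map_eq n g φ.hom
    φ.hom_comp_π
  have h2 : ((Ext R (ModuleCat.{u} R) n).map g.op).app Y =
    ((((linearYoneda R (ModuleCat.{u} R)).obj Y).rightOp.leftDerived n).map g).unop := rfl
  rw [h2, h1]
  exact unop_conj_comp_eq (P'.isoLeftDerivedObj ((linearYoneda R _).obj Y).rightOp n)
    (P.isoLeftDerivedObj ((linearYoneda R _).obj Y).rightOp n) _
    ((P'.homComplex Y).homologyOp n).symm ((P.homComplex Y).homologyOp n).symm _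
    (HomologicalComplex.homologyOp_hom_naturality
      (ProjectiveResolution.homComplexMap φ.hom Y) n)

/-- The comparison of the derived functor of the morphisms into `Y` with `Ext`. -/
noncomputable def extToAbelianExt (X Y : ModuleCat.{u} R) (n : ℕ) :
    ((Ext R (ModuleCat.{u} R) n).obj (op X)).obj Y ⟶ ModuleCat.of R (Abelian.Ext.{u} X Y n) :=
  ((projectiveResolution X).isoExt n Y).hom ≫ (projectiveResolution X).homologyToExt Y n

lemma extToAbelianExt_bijective (X Y : ModuleCat.{u} R) (n : ℕ) :
    Function.Bijective (extToAbelianExt X Y n) := by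
  have h1 : IsIso ((projectiveResolution X).homologyToExt Y n) :=
    (ConcreteCategory.isIso_iff_bijective _).2
      ((projectiveResolution X).homologyToExt_bijective Y n)
  have h2 : IsIso (extToAbelianExt X Y n) := by
    unfold extToAbelianExt
    infer_instance
  exact (ConcreteCategory.isIso_iff_bijective _).1 h2

lemma extToAbelianExt_naturality {X' X : ModuleCat.{u} R} (g : X' ⟶ X) (Y : ModuleCat.{u} R)
    (n : ℕ) (x : ((Ext R (ModuleCat.{u} R) n).obj (op X)).obj Y) :
    extToAbelianExt X' Y n (((Ext R (ModuleCat.{u} R) n).map g.op).app Y x) =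
      (Abelian.Ext.mk₀ g).comp (extToAbelianExt X Y n x) (zero_add n) := by
  let φ : ProjectiveResolution.Hom (projectiveResolution X') (projectiveResolution X) g :=
    { hom := ProjectiveResolution.lift g _ _
      hom_f_zero_comp_π_f_zero :=
        HomologicalComplex.congr_hom (ProjectiveResolution.lift_commutes g _ _) 0 }
  have h1 := ConcreteCategory.congr_hom (isoExt_naturality φ Y n) x
  have h2 := ProjectiveResolution.homologyMap_homologyToExt φ Y n
    (((projectiveResolution X).isoExt n Y).hom x)
  exact (congrArg ((projectiveResolution X').homologyToExt Y n) h1).trans h2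

end

/-! ### Ext from a quotient by a regular sequence into the ring. -/

section
open CategoryTheory.Abelian RingTheory.Sequence Pointwise

variable {R : Type u} [CommRing R]

/-- Precomposition with an isomorphism, on `Ext`. -/
noncomputable def CategoryTheory.Abelian.Ext.precompIso {X X' : ModuleCat.{u} R} (e : X ≅ X')
    (Y : ModuleCat.{u} R) (n : ℕ) : Ext.{u} X' Y n ≃ₗ[R] Ext.{u} X Y n where
  toFun x := (Ext.mk₀ e.hom).comp x (zero_add n)
  map_add' x y := Ext.comp_add _ _ _ _
  map_smul' r x := Ext.comp_smul _ _ _ _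
  invFun x := (Ext.mk₀ e.inv).comp x (zero_add n)
  left_inv x := by simp
  right_inv x := by simp

/-- `Ext X Y` is concentrated in degree `j`, where it is isomorphic to `X`. -/
def ExtSelfConcentrated (X Y : ModuleCat.{u} R) (j : ℕ) : Prop :=
  (∀ k ≠ j, Subsingleton (Ext.{u} X Y k)) ∧ Nonempty (Ext.{u} X Y j ≃ₗ[R] X)

lemma ExtSelfConcentrated.of_linearEquiv {X X' Y : ModuleCat.{u} R} {j : ℕ}
    (h : ExtSelfConcentrated X Y j) (e : X ≃ₗ[R] X') : ExtSelfConcentrated X' Y j := by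
  refine ⟨fun k hk => ?_, ?_⟩
  · have := h.1 k hk
    exact (Ext.precompIso e.toModuleIso Y k).toEquiv.subsingleton
  · obtain ⟨f⟩ := h.2
    exact ⟨(Ext.precompIso e.toModuleIso Y j).trans (f.trans e)⟩

lemma CategoryTheory.Abelian.Ext.mk₀_smul_id_comp {X Y : ModuleCat.{u} R} (g : R) {n : ℕ}
    (x : Ext.{u} X Y n) : (Ext.mk₀ (g • 𝟙 X)).comp x (zero_add n) = g • x := by
  rw [Ext.mk₀_smul, Ext.smul_comp]
  simp

/-- Pullback along `q` vanishes: in degree `j` its image is killed by `g`, which is regular there,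
and the other groups are zero. So a class on `Q` is a connecting image from degree `k - 1 ≠ j`; for
`k = 0` one uses that `q` is epi. -/
lemma subsingleton_ext_of_smul_shortExact {X Q Y : ModuleCat.{u} R} {g : R} {q : X ⟶ Q}
    {w : (g • 𝟙 X) ≫ q = 0} (hS : (ShortComplex.mk (g • 𝟙 X) q w).ShortExact) {j : ℕ}
    (h : ∀ k ≠ j, Subsingleton (Ext.{u} X Y k)) (hg : IsSMulRegular (Ext.{u} X Y j) g) {k : ℕ}
    (hk : k ≠ j + 1) : Subsingleton (Ext.{u} Q Y k) := by
  have hzero (x : Ext.{u} Q Y k) : (Ext.mk₀ q).comp x (zero_add k) = 0 := by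
    by_cases hkj : k = j
    · subst hkj
      apply hg
      dsimp only
      rw [smul_zero, ← Ext.mk₀_smul_id_comp, Ext.mk₀_comp_mk₀_assoc, w]
      simp
    · have := h k hkj
      exact Subsingleton.elim _ _
  refine subsingleton_of_forall_eq 0 fun x => ?_
  cases k with
  | zero =>
    have : Epi q := hS.epi_g
    exact Ext.precomp_mk₀_injective_of_epi Y q ((hzero x).trans (by simp))
  | succ k =>
    obtain ⟨x₁, rfl⟩ := Ext.contravariant_sequence_exact₃ hS Y x (hzero x) (n₀ := k) (by omega)
    have : Subsingleton (Ext.{u} X Y k) := h k (by omega)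
    have h0 : x₁ = 0 := Subsingleton.elim (α := Ext.{u} X Y k) _ _
    rw [h0, Ext.comp_zero]

lemma nonempty_ext_linearEquiv_of_smul_shortExact {X Q Y : ModuleCat.{u} R} {g : R} {q : X ⟶ Q}
    {w : (g • 𝟙 X) ≫ q = 0} (hS : (ShortComplex.mk (g • 𝟙 X) q w).ShortExact) {j : ℕ}
    (h : Subsingleton (Ext.{u} X Y (j + 1))) :
    Nonempty (Ext.{u} Q Y (j + 1) ≃ₗ[R] QuotSMulTop g (Ext.{u} X Y j)) := by
  let δ : Ext.{u} X Y j →ₗ[R] Ext.{u} Q Y (j + 1) :=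
    { toFun x := hS.extClass.comp x (add_comm 1 j)
      map_add' x y := Ext.comp_add _ _ _ _
      map_smul' r x := Ext.comp_smul _ _ _ _ }
  have hδ : Function.Surjective δ := fun x =>
    Ext.contravariant_sequence_exact₃ hS Y x (Subsingleton.elim (α := Ext.{u} X Y (j + 1)) _ _)
      (add_comm 1 j)
  have hker : LinearMap.ker δ = g • (⊤ : Submodule R (Ext.{u} X Y j)) := by
    ext x
    rw [LinearMap.mem_ker, Submodule.mem_smul_pointwise_iff_exists]
    constructor
    · intro hx
      obtain ⟨y, hy⟩ := Ext.contravariant_sequence_exact₁ hS Y x (add_comm 1 j) hx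
      exact ⟨y, trivial, (Ext.mk₀_smul_id_comp g y).symm.trans hy⟩
    · rintro ⟨y, -, rfl⟩
      rw [← Ext.mk₀_smul_id_comp]
      exact (ShortComplex.ShortExact.extClass_comp_assoc (h := add_comm 1 j) hS y)
  exact ⟨(δ.quotKerEquivOfSurjective hδ).symm.trans (Submodule.quotEquivOfEq _ _ hker)⟩

/-- The surviving group is the cokernel of `g` on `Ext^j(X, Y)`. The isomorphism of that group with
`X` does two jobs: it transfers the regularity of `g`, and it identifies the cokernel with `X/gX`,
so that the property propagates along a regular sequence. -/
lemma ExtSelfConcentrated.quotSMulTop {X Y : ModuleCat.{u} R} {j : ℕ}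
    (h : ExtSelfConcentrated X Y j) {g : R} (hg : IsSMulRegular X g) :
    ExtSelfConcentrated (ModuleCat.of R (QuotSMulTop g X)) Y (j + 1) := by
  have hS := hg.smulShortComplex_shortExact
  obtain ⟨e⟩ := h.2
  refine ⟨fun k hk => subsingleton_ext_of_smul_shortExact hS h.1 ?_ hk, ?_⟩
  · exact (e.isSMulRegular_congr g).2 hg
  · obtain ⟨f⟩ := nonempty_ext_linearEquiv_of_smul_shortExact hS (h.1 (j + 1) (by omega))
    exact ⟨f.trans (QuotSMulTop.congr g e)⟩

lemma ExtSelfConcentrated.quotient_ofList {X Y : ModuleCat.{u} R} {j : ℕ}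
    (h : ExtSelfConcentrated X Y j) {rs : List R} (hrs : IsWeaklyRegular X rs) :
    ExtSelfConcentrated (ModuleCat.of R (X ⧸ Ideal.ofList rs • (⊤ : Submodule R X))) Y
      (j + rs.length) := by
  induction rs generalizing X j with
  | nil =>
    refine h.of_linearEquiv (X' := ModuleCat.of R _) (Submodule.quotEquivOfEqBot _ ?_).symm
    simp
  | cons g rs ih =>
    rw [isWeaklyRegular_cons_iff] at hrs
    have h1 := ih (h.quotSMulTop hrs.1) hrs.2
    have h2 := h1.of_linearEquiv (X' := ModuleCat.of R _)
      (Submodule.quotOfListConsSMulTopEquivQuotSMulTopInner X g rs).symm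
    rw [List.length_cons, ← add_assoc, add_right_comm]
    exact h2

lemma extSelfConcentrated_self :
    ExtSelfConcentrated (ModuleCat.of R R) (ModuleCat.of R R) 0 := by
  have : Projective (ModuleCat.of R R) := ModuleCat.projective_of_free (Module.Basis.singleton Unit R)
  refine ⟨fun k hk => ?_, ⟨?_⟩⟩
  · obtain ⟨k, rfl⟩ := Nat.exists_eq_succ_of_ne_zero hk
    exact Ext.subsingleton_of_projective _ _ k
  · exact Ext.linearEquiv₀.trans (ModuleCat.homLinearEquiv.trans (LinearMap.ringLmapEquivSelf R R R))

lemma extSelfConcentrated_quotient_ofList {rs : List R} (hrs : IsWeaklyRegular R rs) :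
    ExtSelfConcentrated (ModuleCat.of R (R ⧸ Ideal.ofList rs)) (ModuleCat.of R R) rs.length := by
  have h := (extSelfConcentrated_self (R := R)).quotient_ofList hrs
  rw [zero_add] at h
  exact h.of_linearEquiv (X' := ModuleCat.of R _) (Submodule.quotEquivOfEq _ _ (by simp))
end

/-! ### A dualizing class: shifting Ext by the length of a regular sequence. -/

section
open CategoryTheory.Abelian RingTheory.Sequence Pointwise

variable {R : Type u} [CommRing R]

/-- On this group `r` acts as zero through `X` and invertibly through `L`. -/
lemma subsingleton_ext_of_smul_eq_zero_of_isUnit {X L : ModuleCat.{u} R} {r : R}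
    (hX : ∀ x : X, r • x = 0) (hL : IsUnit (algebraMap R (Module.End R L) r)) (k : ℕ) :
    Subsingleton (Ext.{u} X L k) := by
  refine subsingleton_of_forall_eq 0 fun e => ?_
  obtain ⟨v, hv⟩ := hL.exists_right_inv
  have hX0 : r • 𝟙 X = 0 := by
    ext x
    exact hX x
  have hre : r • e = 0 := by
    rw [← Ext.mk₀_smul_id_comp, hX0]
    simp
  have hcomp : ModuleCat.ofHom v ≫ (r • 𝟙 L) = 𝟙 L := by
    ext y
    exact LinearMap.congr_fun hv y
  have h1 : e = (e.comp (Ext.mk₀ (ModuleCat.ofHom v)) (add_zero k)).comp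
      (Ext.mk₀ (r • 𝟙 L)) (add_zero k) := by
    rw [Ext.comp_assoc_of_third_deg_zero, Ext.mk₀_comp_mk₀, hcomp]
    simp
  rw [h1, ← Ext.smul_eq_comp_mk₀, ← Ext.smul_comp, hre]
  simp

lemma bijective_comp_extClass_of_subsingleton {S : ShortComplex (ModuleCat.{u} R)}
    (hS : S.ShortExact) (X : ModuleCat.{u} R) (h : ∀ k, Subsingleton (Ext.{u} X S.X₂ k))
    {k m : ℕ} (hm : k + 1 = m) :
    Function.Bijective fun e : Ext.{u} X S.X₃ k => e.comp hS.extClass hm := by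
  constructor
  · refine (injective_iff_map_eq_zero (hS.extClass.postcomp X hm)).2 fun e he => ?_
    obtain ⟨y, rfl⟩ := Ext.covariant_sequence_exact₃ X hS e hm he
    have := h k
    rw [Subsingleton.elim y 0, Ext.zero_comp]
  · intro e
    have := h m
    exact Ext.covariant_sequence_exact₁ X hS e (Subsingleton.elim _ _) hm

/-- If `g • y = 0`, then the cyclic module `Ry` is killed by powers of all members of `gs ++ [g]`.
This ideal has grade above `gs.length`, so `Ext^{gs.length}(Ry, R) = 0`. By the shift `Hom(Ry, N) =
0`, and the inclusion of `Ry` is zero. -/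
lemma eq_zero_of_smul_eq_zero_of_bijective_comp [IsNoetherianRing R] {N : ModuleCat.{u} R}
    {gs : List R} {g : R} (hgs : IsRegular R (gs ++ [g]))
    {c : Ext.{u} N (ModuleCat.of R R) gs.length}
    (htors : ∀ r ∈ gs, ∀ y : N, ∃ n : ℕ, r ^ n • y = 0)
    (hbij : ∀ X : ModuleCat.{u} R, (∀ r ∈ gs, ∃ n : ℕ, ∀ x : X, r ^ n • x = 0) →
      Function.Bijective fun e : Ext.{u} X N 0 => e.comp c (zero_add _))
    (y : N) (hy : g • y = 0) : y = 0 := by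
  let X : ModuleCat.{u} R := ModuleCat.of R (Submodule.span R {y})
  have hX : ∀ r : R, r • y = 0 → ∀ x : X, r • x = 0 := by
    rintro r hr ⟨x, hx⟩
    obtain ⟨a, rfl⟩ := Submodule.mem_span_singleton.1 hx
    apply Subtype.ext
    change r • a • y = 0
    rw [smul_comm, hr, smul_zero]
  have hsub : Subsingleton (Ext.{u} X (ModuleCat.of R R) gs.length) := by
    refine ModuleCat.subsingleton_ext_of_exists_isRegular (Ideal.ofList (gs ++ [g])) X ?_
      (ModuleCat.of R R) ?_ (gs ++ [g]) (fun r hr => Ideal.subset_span hr) hgs _ (by simp)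
    · rw [Module.support_eq_zeroLocus, PrimeSpectrum.zeroLocus_subset_zeroLocus_iff,
        Ideal.ofList, Ideal.span_le]
      intro r hr
      have : ∃ n : ℕ, r ^ n • y = 0 := by
        rcases List.mem_append.1 hr with hr | hr
        · exact htors r hr y
        · rw [List.mem_singleton.1 hr]
          exact ⟨1, by rwa [pow_one]⟩
      obtain ⟨n, hn⟩ := this
      exact ⟨n, Module.mem_annihilator.2 (hX _ hn)⟩
    · exact lt_top_iff_ne_top.2 hgs.top_ne_smul.symm
  have hinj := (hbij X fun r hr => (htors r hr y).imp fun n hn => hX _ hn).injective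
  have h0 : Ext.mk₀ (ModuleCat.ofHom (Submodule.span R {y}).subtype : X ⟶ N) = 0 :=
    hinj (Subsingleton.elim (α := Ext.{u} X (ModuleCat.of R R) gs.length) _ _)
  rw [Ext.mk₀_eq_zero_iff] at h0
  exact ConcreteCategory.congr_hom h0 (⟨y, Submodule.mem_span_singleton_self y⟩ : X)

/-- `N` is built by iterating `N ↦ N_g/N` from `R`, and `c` is the product of the classes of `0 → N
→ N_g → N_g/N → 0`. Each class shifts `Ext(X, -)` isomorphically, because `Ext(X, N_g) = 0` when a
power of `g` kills `X`. -/
lemma exists_ext_shift [IsNoetherianRing R] (gs : List R) (hgs : IsRegular R gs) :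
    ∃ (N : ModuleCat.{u} R) (c : Ext.{u} N (ModuleCat.of R R) gs.length),
      (∀ r ∈ gs, ∀ y : N, ∃ n : ℕ, r ^ n • y = 0) ∧
      ∀ X : ModuleCat.{u} R, (∀ r ∈ gs, ∃ n : ℕ, ∀ x : X, r ^ n • x = 0) →
        ∀ (k m : ℕ) (hm : k + gs.length = m),
          Function.Bijective fun e : Ext.{u} X N k => e.comp c hm := by
  induction gs using List.reverseRecOn with
  | nil =>
    refine ⟨ModuleCat.of R R, Ext.mk₀ (𝟙 _), by simp, fun X _ k m hm => ?_⟩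
    obtain rfl : k = m := by simpa using hm
    convert Function.bijective_id using 1
    ext e
    exact Ext.comp_mk₀_id e
  | append_singleton gs g ih =>
    have hgs' : IsRegular R gs := by
      refine ⟨((isWeaklyRegular_append_iff _ _ _).1 hgs.1).1, fun h => hgs.2 ?_⟩
      refine (eq_top_iff.2 ?_).symm
      rw [Ideal.ofList_append]
      exact h.le.trans (Submodule.smul_mono_left le_sup_left)
    obtain ⟨N, c, htors, hbij⟩ := ih hgs'
    have hreg := eq_zero_of_smul_eq_zero_of_bijective_comp hgs htors
      fun X hX => hbij X hX 0 _ (zero_add _)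
    let L := LocalizedModule (Submonoid.powers g) N
    let ι : N →ₗ[R] L := LocalizedModule.mkLinearMap (Submonoid.powers g) N
    have hι : Function.Injective ι := by
      refine (injective_iff_map_eq_zero ι).2 fun y hy => ?_
      obtain ⟨⟨_, n, rfl⟩, hn⟩ := (IsLocalizedModule.eq_zero_iff (Submonoid.powers g) ι).1 hy
      change g ^ n • y = 0 at hn
      induction n with
      | zero => simpa using hn
      | succ n ihn =>
        rw [pow_succ', mul_smul] at hn
        exact ihn (hreg _ hn)
    have hsurj : ∀ z : L, ∃ n : ℕ, ∃ y : N, g ^ n • z = ι y := fun z => by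
      obtain ⟨⟨y, ⟨_, n, rfl⟩⟩, hz⟩ := IsLocalizedModule.surj (Submonoid.powers g) ι z
      exact ⟨n, y, hz⟩
    let N' : ModuleCat.{u} R := ModuleCat.of R (L ⧸ LinearMap.range ι)
    let S : ShortComplex (ModuleCat.{u} R) := ShortComplex.mk (ModuleCat.ofHom ι)
      (ModuleCat.ofHom (LinearMap.range ι).mkQ : ModuleCat.of R L ⟶ N') (by
        ext y
        exact (Submodule.Quotient.mk_eq_zero _).2 ⟨y, rfl⟩)
    have hS : S.ShortExact := by
      refine ModuleCat.shortComplex_shortExact S ?_ hι (Submodule.mkQ_surjective _)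
      exact LinearMap.exact_map_mkQ_range ι
    have hunit : ∀ n : ℕ, IsUnit (algebraMap R (Module.End R L) (g ^ n)) := fun n =>
      IsLocalizedModule.map_units ι (⟨g ^ n, n, rfl⟩ : Submonoid.powers g)
    refine ⟨N', hS.extClass.comp c (by simp [add_comm]), fun r hr y => ?_, fun X hX k m hm => ?_⟩
    · obtain ⟨z, rfl⟩ := Submodule.mkQ_surjective _ y
      obtain ⟨n, y, hy⟩ := hsurj z
      rcases List.mem_append.1 hr with hr | hr
      · obtain ⟨k, hk⟩ := htors r hr y
        refine ⟨k, ?_⟩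
        -- The denominator `g ^ n` acts invertibly on `L`, so it suffices to check this after
        -- multiplying by it.
        have : r ^ k • z = 0 := by
          refine (Module.End.isUnit_iff _).1 (hunit n) |>.injective ?_
          change g ^ n • r ^ k • z = g ^ n • (0 : L)
          rw [smul_comm, hy, ← map_smul, hk, map_zero, smul_zero]
        rw [← map_smul, this, map_zero]
      · rw [List.mem_singleton.1 hr]
        refine ⟨n, ?_⟩
        rw [← map_smul, hy]
        exact (Submodule.Quotient.mk_eq_zero _).2 ⟨y, rfl⟩
    · obtain ⟨n, hn⟩ := hX g (by simp)
      have h1 := bijective_comp_extClass_of_subsingleton hS X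
        (fun k => subsingleton_ext_of_smul_eq_zero_of_isUnit hn (hunit n) k) (rfl : k + 1 = k + 1)
      have h2 := hbij X (fun r hr => hX r (by simp [hr])) (k + 1) m
        (by rw [← hm, List.length_append, List.length_singleton]; omega)
      convert h2.comp h1 using 1
      ext e
      exact (Ext.comp_assoc _ _ _ _ _ (by
        rw [← hm, List.length_append, List.length_singleton]; omega)).symm

end

/-! ### Local cohomology of the ring along a regular sequence. -/

section
open CategoryTheory.Abelian RingTheory.Sequence Limits Opposite

variable {R : Type u} [CommRing R]

lemma Ideal.mem_ofList_of_mem {rs : List R} {r : R} (hr : r ∈ rs) : r ∈ Ideal.ofList rs :=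
  Ideal.subset_span hr

lemma subsingleton_pt_of_isColimit_of_map_eq_zero {J : Type} [SmallCategory J]
    {G : J ⥤ ModuleCat.{u} R} {c : Cocone G} (hc : IsColimit c)
    (h : ∀ (j : J) (x : G.obj j), ∃ (j' : J) (f : j ⟶ j'), G.map f x = 0) :
    Subsingleton c.pt := by
  have hid : 𝟙 c.pt = 0 := hc.hom_ext fun j => by
    ext x
    obtain ⟨j', f, hf⟩ := h j x
    have h1 := ConcreteCategory.congr_hom (c.w f) x
    have h2 : c.ι.app j' (G.map f x) = c.ι.app j x := h1
    rw [hf, map_zero] at h2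
    rw [Category.comp_id, comp_zero]
    exact h2.symm
  exact subsingleton_of_forall_eq 0 fun z => ConcreteCategory.congr_hom hid z

lemma nonempty_linearEquiv_pt_of_isColimit {J : Type} [SmallCategory J] [IsFiltered J]
    {G : J ⥤ ModuleCat.{u} R} {c : Cocone G} (hc : IsColimit c) (d : Cocone G)
    (hinj : ∀ j, Function.Injective (d.ι.app j))
    (hsurj : ∀ y : d.pt, ∃ j x, d.ι.app j x = y) : Nonempty (c.pt ≃ₗ[R] d.pt) := by
  have : PreservesFilteredColimitsOfSize.{0, 0} (forget (ModuleCat.{u} R)) :=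
    preservesSmallestFilteredColimits_of_preservesFilteredColimits.{u, u} _
  have hfac (j : J) (x : G.obj j) : hc.desc d (c.ι.app j x) = d.ι.app j x :=
    ConcreteCategory.congr_hom (hc.fac d j) x
  refine ⟨LinearEquiv.ofBijective (hc.desc d).hom ⟨?_, fun y => ?_⟩⟩
  · refine (injective_iff_map_eq_zero _).2 fun z hz => ?_
    obtain ⟨j, x, rfl⟩ := Concrete.isColimit_exists_rep G hc z
    have h0 : x = 0 := hinj j (((hfac j x).symm.trans hz).trans (map_zero (d.ι.app j).hom).symm)
    rw [h0, map_zero]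
  · obtain ⟨j, x, rfl⟩ := hsurj y
    exact ⟨c.ι.app j x, hfac j x⟩

/-- Regular sequences permute here, so each element can be moved to the end, where raising it to a
power is harmless. The tail `l₂` collects the powers already treated. -/
lemma RingTheory.Sequence.IsRegular.map_pow [IsLocalRing R] [IsNoetherianRing R]
    (n : ℕ) (hn : n ≠ 0) {l₁ l₂ : List R} (h : IsRegular R (l₁ ++ l₂)) :
    IsRegular R (l₁.map (· ^ n) ++ l₂) := by
  induction l₁ generalizing l₂ with
  | nil => exact h
  | cons a l ih =>
    have h1 : IsRegular R ((l ++ l₂) ++ [a]) :=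
      isRegular_of_perm h (by
        rw [List.cons_append]
        exact (List.perm_append_singleton _ _).symm)
    have h2 : IsRegular R ((l ++ l₂) ++ [a ^ n]) := by
      have hw := (isWeaklyRegular_append_iff _ _ _).1 h1.1
      refine IsRegular.of_isWeaklyRegular_of_mem_maximalIdeal R (fun r hr => ?_)
        ((isWeaklyRegular_append_iff _ _ _).2 ⟨hw.1, ?_⟩)
      · have hmem : ∀ r ∈ (l ++ l₂) ++ [a], r ∈ maximalIdeal R := fun r hr =>
          le_maximalIdeal (J := Ideal.ofList ((l ++ l₂) ++ [a])) (fun h => h1.2 (by rw [h]; simp))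
            (Ideal.mem_ofList_of_mem hr)
        rcases List.mem_append.1 hr with hr | hr
        · exact hmem r (by simp only [List.mem_append] at hr ⊢; exact Or.inl hr)
        · rw [List.mem_singleton.1 hr]
          exact Ideal.pow_mem_of_mem _ (hmem a (by simp)) n (Nat.pos_of_ne_zero hn)
      · rw [isWeaklyRegular_singleton_iff] at hw ⊢
        exact hw.2.pow n
    have h3 : IsRegular R (l ++ a ^ n :: l₂) := isRegular_of_perm h2
      ((List.perm_append_singleton _ _).trans List.perm_middle.symm)
    exact isRegular_of_perm (ih h3) List.perm_middle

/-- The inclusion of powers of an ideal, on the quotients. -/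
noncomputable def quotientPowMap (I : Ideal R) {m n : ℕ} (h : n ≤ m) :
    ModuleCat.of R (R ⧸ I ^ m) ⟶ ModuleCat.of R (R ⧸ I ^ n) :=
  ModuleCat.ofHom (Submodule.mapQ _ _ LinearMap.id (Ideal.pow_le_pow_right h))

/-- The directed system of `Ext` groups whose colimit is local cohomology. -/
noncomputable abbrev localCohomologySystem (I : Ideal R) (k : ℕ) (M : ModuleCat.{u} R) :
    (ℕᵒᵖ)ᵒᵖ ⥤ ModuleCat.{u} R :=
  localCohomology.diagram (localCohomology.idealPowersDiagram I) k ⋙ (evaluation _ _).obj M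

/-- The local cohomology module as a colimit of `Ext` groups. -/
noncomputable def localCohomologyIsColimit (I : Ideal R) (k : ℕ) (M : ModuleCat.{u} R) :
    IsColimit (((evaluation _ _).obj M).mapCocone (colimit.cocone
      (localCohomology.diagram (localCohomology.idealPowersDiagram I) k))) :=
  isColimitOfPreserves ((evaluation _ _).obj M) (colimit.isColimit _)

lemma extToAbelianExt_localCohomologySystem_map (I : Ideal R) (k : ℕ) (M : ModuleCat.{u} R)
    {a b : (ℕᵒᵖ)ᵒᵖ} (f : a ⟶ b) (x : (localCohomologySystem I k M).obj a) :
    extToAbelianExt (ModuleCat.of R (R ⧸ I ^ b.unop.unop)) M k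
        ((localCohomologySystem I k M).map f x) =
      (Ext.mk₀ (quotientPowMap I f.unop.unop.down.down)).comp
        (extToAbelianExt (ModuleCat.of R (R ⧸ I ^ a.unop.unop)) M k x) (zero_add k) :=
  extToAbelianExt_naturality (quotientPowMap I f.unop.unop.down.down) M k x

/-- The powers of `I` are cofinal with the ideals `J` generated by powers of the members of `gs`. A
transition map of the Ext system therefore factors through `Ext^k(R/J, R)`, which is zero since
those powers are again a regular sequence. -/
lemma subsingleton_localCohomology_of_ne_length [IsLocalRing R] [IsNoetherianRing R]
    {gs : List R} (hgs : IsRegular R gs) {k : ℕ} (hk : k ≠ gs.length) :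
    Subsingleton ((localCohomology (Ideal.ofList gs) k).obj (ModuleCat.of R R)) := by
  set I := Ideal.ofList gs with hI
  refine subsingleton_pt_of_isColimit_of_map_eq_zero
    (localCohomologyIsColimit I k (ModuleCat.of R R)) fun a x => ?_
  set n := a.unop.unop with hn
  -- The exponent `n + 1` stays nonzero when `n = 0`, as `IsRegular.map_pow` requires.
  have hpow : IsRegular R (gs.map (· ^ (n + 1))) := by
    have := IsRegular.map_pow (n + 1) (by omega) (l₁ := gs) (l₂ := []) (by simpa using hgs)
    simpa using this
  set J := Ideal.ofList (gs.map (· ^ (n + 1))) with hJ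
  have hJI : J ≤ I ^ n := by
    rw [hJ, Ideal.ofList, Ideal.span_le]
    rintro r hr
    obtain ⟨g, hg, rfl⟩ := List.mem_map.1 hr
    exact Ideal.pow_le_pow_right (Nat.le_succ n) (Ideal.pow_mem_pow (Ideal.mem_ofList_of_mem hg) _)
  have hIJ : I ≤ J.radical := by
    rw [hI, Ideal.ofList, Ideal.span_le]
    intro g hg
    exact ⟨n + 1, Ideal.subset_span (List.mem_map.2 ⟨g, hg, rfl⟩)⟩
  obtain ⟨m, hm⟩ := Ideal.exists_pow_le_of_le_radical_of_fg hIJ (IsNoetherian.noetherian I)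
  have hIm : I ^ (max m n) ≤ J := (Ideal.pow_le_pow_right (le_max_left _ _)).trans hm
  have : Subsingleton (Ext.{u} (ModuleCat.of R (R ⧸ J)) (ModuleCat.of R R) k) :=
    (extSelfConcentrated_quotient_ofList hpow.1).1 k (by rwa [List.length_map])
  let f : a ⟶ op (op (max m n)) := (homOfLE (le_max_right m n)).op.op
  refine ⟨_, f, (extToAbelianExt_bijective _ _ _).injective ?_⟩
  refine Eq.trans ?_ (map_zero (extToAbelianExt _ _ _).hom).symm
  refine (extToAbelianExt_localCohomologySystem_map I k _ f x).trans ?_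
  have hfac : quotientPowMap I f.unop.unop.down.down =
      (ModuleCat.ofHom (Submodule.factor hIm) : ModuleCat.of R (R ⧸ I ^ (max m n)) ⟶
        ModuleCat.of R (R ⧸ J)) ≫ ModuleCat.ofHom (Submodule.factor hJI) := by
    ext
    rfl
  rw [hfac, ← Ext.mk₀_comp_mk₀, Ext.comp_assoc_of_second_deg_zero]
  rw [Subsingleton.elim (α := Ext.{u} (ModuleCat.of R (R ⧸ J)) (ModuleCat.of R R) k)
    (Ext.comp _ _ _) 0, Ext.comp_zero]
  rfl

/-- The shift turns `Ext(R/I^n, R)` in this degree into `Hom(R/I^n, N)`, the `I^n`-torsion of `N`.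
The colimit is the union of these submodules, which is all of `N` because `N` is torsion. -/
lemma nonempty_localCohomology_length_linearEquiv [IsNoetherianRing R]
    {gs : List R} {N : ModuleCat.{u} R} {c : Ext.{u} N (ModuleCat.of R R) gs.length}
    (htors : ∀ r ∈ gs, ∀ y : N, ∃ n : ℕ, r ^ n • y = 0)
    (hbij : ∀ X : ModuleCat.{u} R, (∀ r ∈ gs, ∃ n : ℕ, ∀ x : X, r ^ n • x = 0) →
      Function.Bijective fun e : Ext.{u} X N 0 => e.comp c (zero_add _)) :
    Nonempty ((localCohomology (Ideal.ofList gs) gs.length).obj (ModuleCat.of R R) ≃ₗ[R] N) := by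
  set I := Ideal.ofList gs with hI
  have hker : ∀ n, ∀ r ∈ gs, ∃ m : ℕ, ∀ x : R ⧸ I ^ n, r ^ m • x = 0 := fun n r hr => by
    refine ⟨n, fun x => ?_⟩
    obtain ⟨x, rfl⟩ := Ideal.Quotient.mk_surjective x
    exact (Submodule.Quotient.mk_eq_zero _).2
      (Ideal.mul_mem_right _ _ (Ideal.pow_mem_pow (Ideal.mem_ofList_of_mem hr) n))
  let shift (n : ℕ) : Ext.{u} (ModuleCat.of R (R ⧸ I ^ n)) N 0 ≃ₗ[R]
      Ext.{u} (ModuleCat.of R (R ⧸ I ^ n)) (ModuleCat.of R R) gs.length :=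
    LinearEquiv.ofBijective
      { toFun e := e.comp c (zero_add _)
        map_add' x y := Ext.add_comp _ _ _ _
        map_smul' r x := Ext.smul_comp _ _ _ _ } (hbij _ (hker n))
  let evalOne (n : ℕ) : Ext.{u} (ModuleCat.of R (R ⧸ I ^ n)) N 0 →ₗ[R] N :=
    LinearMap.applyₗ (1 : R ⧸ I ^ n) ∘ₗ
      (ModuleCat.homLinearEquiv (S := R)).toLinearMap ∘ₗ (Ext.linearEquiv₀ (R := R)).toLinearMap
  have evalOne_mk₀ : ∀ n (u : ModuleCat.of R (R ⧸ I ^ n) ⟶ N),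
      evalOne n (Ext.mk₀ u) = u (1 : R ⧸ I ^ n) := fun n u => by
    have : Ext.linearEquiv₀ (R := R) (Ext.mk₀ u) = u :=
      (Ext.linearEquiv₀ (R := R)).apply_symm_apply u
    simp only [evalOne, LinearMap.comp_apply, LinearEquiv.coe_coe, this]
    rfl
  have mk₀_surj : ∀ n (e : Ext.{u} (ModuleCat.of R (R ⧸ I ^ n)) N 0), ∃ u, e = Ext.mk₀ u :=
    fun n e => ⟨_, (Ext.mk₀_linearEquiv₀_apply (R := R) e).symm⟩
  -- The cocone maps undo the shift and evaluate the resulting morphism `R/I^n → N` at `1`.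
  let φ (n : ℕ) : (localCohomologySystem I gs.length (ModuleCat.of R R)).obj (op (op n)) →ₗ[R] N :=
    evalOne n ∘ₗ (shift n).symm.toLinearMap ∘ₗ
      (extToAbelianExt (ModuleCat.of R (R ⧸ I ^ n)) (ModuleCat.of R R) gs.length).hom
  let d : Cocone (localCohomologySystem I gs.length (ModuleCat.of R R)) :=
    { pt := N
      ι :=
        { app a := ModuleCat.ofHom (φ a.unop.unop)
          naturality a b f := by
            ext x
            have h1 := extToAbelianExt_localCohomologySystem_map I gs.length (ModuleCat.of R R) f x
            obtain ⟨e, he⟩ := (shift a.unop.unop).surjective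
              (extToAbelianExt (ModuleCat.of R (R ⧸ I ^ a.unop.unop)) (ModuleCat.of R R) _ x)
            obtain ⟨u, rfl⟩ := mk₀_surj _ e
            have h2 : (shift a.unop.unop).symm (extToAbelianExt
                (ModuleCat.of R (R ⧸ I ^ a.unop.unop)) (ModuleCat.of R R) _ x) = Ext.mk₀ u := by
              rw [← he, LinearEquiv.symm_apply_apply]
            have h3 : (shift b.unop.unop).symm (extToAbelianExt
                (ModuleCat.of R (R ⧸ I ^ b.unop.unop)) (ModuleCat.of R R) _
                ((localCohomologySystem I gs.length (ModuleCat.of R R)).map f x)) =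
                Ext.mk₀ (quotientPowMap I f.unop.unop.down.down ≫ u) := by
              rw [LinearEquiv.symm_apply_eq]
              refine h1.trans ?_
              rw [← he, ← Ext.mk₀_comp_mk₀]
              exact (Ext.comp_assoc_of_second_deg_zero _ _ _ _).symm
            change evalOne _ ((shift b.unop.unop).symm (extToAbelianExt
                (ModuleCat.of R (R ⧸ I ^ b.unop.unop)) (ModuleCat.of R R) _
                ((localCohomologySystem I gs.length (ModuleCat.of R R)).map f x))) =
              evalOne _ ((shift a.unop.unop).symm (extToAbelianExt
                (ModuleCat.of R (R ⧸ I ^ a.unop.unop)) (ModuleCat.of R R) _ x))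
            rw [h2, h3, evalOne_mk₀, evalOne_mk₀]
            rfl } }
  refine nonempty_linearEquiv_pt_of_isColimit
    (localCohomologyIsColimit I gs.length (ModuleCat.of R R)) d (fun a => ?_) fun y => ?_
  · change Function.Injective (evalOne a.unop.unop ∘ (shift a.unop.unop).symm ∘
      (extToAbelianExt (ModuleCat.of R (R ⧸ I ^ a.unop.unop)) (ModuleCat.of R R) gs.length))
    refine Function.Injective.comp ?_ ((shift _).symm.injective.comp
      (extToAbelianExt_bijective _ _ _).injective)
    intro e e' h
    obtain ⟨u, rfl⟩ := mk₀_surj _ e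
    obtain ⟨u', rfl⟩ := mk₀_surj _ e'
    rw [evalOne_mk₀, evalOne_mk₀] at h
    congr 1
    ext
    exact h
  · have hrad : I ≤ Ideal.radical (LinearMap.ker (LinearMap.toSpanSingleton R N y)) := by
      rw [hI, Ideal.ofList, Ideal.span_le]
      intro r hr
      obtain ⟨n, hn⟩ := htors r hr y
      exact ⟨n, hn⟩
    obtain ⟨n, hn⟩ := Ideal.exists_pow_le_of_le_radical_of_fg hrad (IsNoetherian.noetherian I)
    let v : ModuleCat.of R (R ⧸ I ^ n) ⟶ N :=
      ModuleCat.ofHom (Submodule.liftQ _ (LinearMap.toSpanSingleton R N y) hn)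
    obtain ⟨x, hx⟩ := (extToAbelianExt_bijective (ModuleCat.of R (R ⧸ I ^ n))
      (ModuleCat.of R R) gs.length).surjective (shift n (Ext.mk₀ v))
    refine ⟨op (op n), x, ?_⟩
    change evalOne n ((shift n).symm (extToAbelianExt _ _ _ x)) = y
    rw [hx, LinearEquiv.symm_apply_apply, evalOne_mk₀]
    exact one_smul R y

end

/-! ### Ext from the residue field into local cohomology. -/

section
open CategoryTheory.Abelian RingTheory.Sequence

variable {R : Type u} [CommRing R]

/-- Postcomposition with an isomorphism, on `Ext`. -/
noncomputable def CategoryTheory.Abelian.Ext.postcompIso (X : ModuleCat.{u} R)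
    {Y Y' : ModuleCat.{u} R} (e : Y ≅ Y') (n : ℕ) : Ext.{u} X Y n ≃ₗ[R] Ext.{u} X Y' n where
  toFun x := x.comp (Ext.mk₀ e.hom) (add_zero n)
  map_add' x y := Ext.add_comp _ _ _ _
  map_smul' r x := Ext.smul_comp _ _ _ _
  invFun x := x.comp (Ext.mk₀ e.inv) (add_zero n)
  left_inv x := by simp
  right_inv x := by simp

variable [IsLocalRing R]

/-- Linearity over `R` implies linearity over the residue field because the residue map is
surjective. -/
lemma rank_extResidue_eq_one {M : ModuleCat.{u} R} {i : ℕ}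
    (e : ExtResidue R M i ≃ₗ[R] ResidueField R) :
    Module.rank (ResidueField R) (ExtResidue R M i) = 1 := by
  let e' : ExtResidue R M i ≃ₗ[ResidueField R] ResidueField R :=
    { e with
      map_smul' := fun a x => by
        obtain ⟨a, rfl⟩ := residue_surjective a
        rw [residue_smul_extResidue]
        refine (e.map_smul a x).trans ?_
        rw [Algebra.smul_def]
        rfl }
  rw [e'.rank_eq, Module.rank_self]

lemma rank_extResidue_localCohomology [IsNoetherianRing R] {gs ts : List R}
    (hgs : IsRegular R gs) (hts : IsRegular R ts) (hm : Ideal.ofList ts = maximalIdeal R)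
    (k i : ℕ) :
    Module.rank (ResidueField R)
      (ExtResidue R ((localCohomology (Ideal.ofList gs) k).obj (ModuleCat.of R R)) i) =
      if k = gs.length ∧ i + gs.length = ts.length then 1 else 0 := by
  by_cases hk : k = gs.length
  · subst hk
    obtain ⟨N, c, htors, hbij⟩ := exists_ext_shift gs hgs
    obtain ⟨e⟩ := nonempty_localCohomology_length_linearEquiv htors
      fun X hX => hbij X hX 0 _ (zero_add _)
    have hK : ∀ r ∈ gs, ∃ n : ℕ, ∀ x : ModuleCat.of R (ResidueField R), r ^ n • x = 0 := by
      intro r hr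
      have hr' : r ∈ maximalIdeal R := le_maximalIdeal (J := Ideal.ofList gs)
        (fun h => hgs.2 (by rw [h]; simp)) (Ideal.mem_ofList_of_mem hr)
      refine ⟨1, fun x => ?_⟩
      rw [pow_one, Algebra.smul_def, ResidueField.algebraMap_eq, (residue_eq_zero_iff r).2 hr',
        zero_mul]
    let e₁ := Ext.postcompIso (ModuleCat.of R (ResidueField R)) e.toModuleIso i
    let e₂ : Ext.{u} (ModuleCat.of R (ResidueField R)) N i ≃ₗ[R]
        Ext.{u} (ModuleCat.of R (ResidueField R)) (ModuleCat.of R R) (i + gs.length) :=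
      LinearEquiv.ofBijective
        { toFun e := e.comp c rfl
          map_add' x y := Ext.add_comp _ _ _ _
          map_smul' r x := Ext.smul_comp _ _ _ _ } (hbij _ hK i _ rfl)
    have hconc : ExtSelfConcentrated (ModuleCat.of R (ResidueField R)) (ModuleCat.of R R)
        ts.length := (extSelfConcentrated_quotient_ofList hts.1).of_linearEquiv
      (X' := ModuleCat.of R (ResidueField R)) (Submodule.quotEquivOfEq _ _ hm)
    split_ifs with h
    · obtain ⟨f⟩ := hconc.2
      rw [← h.2] at f
      exact rank_extResidue_eq_one ((e₁.trans e₂).trans f)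
    · have := hconc.1 (i + gs.length) fun h' => h ⟨rfl, h'⟩
      have := (e₁.trans e₂).toEquiv.subsingleton
      exact rank_subsingleton' _ _
  · rw [if_neg fun h => hk h.1]
    have := subsingleton_localCohomology_of_ne_length hgs hk
    have : Subsingleton (ExtResidue R
        ((localCohomology (Ideal.ofList gs) k).obj (ModuleCat.of R R)) i) := by
      refine subsingleton_of_forall_eq 0 fun x => ?_
      rw [← Ext.comp_mk₀_id x, (ModuleCat.isZero_of_subsingleton _).eq_of_src (𝟙 _) 0]
      simp
    exact rank_subsingleton' _ _

end

/-! ### Generators of the maximal ideal, and quotients by one element. -/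

section
open RingTheory.Sequence
open scoped Pointwise

lemma Ideal.spanFinrank_ofList_le {R : Type*} [CommRing R] (l : List R) :
    (Ideal.ofList l).spanFinrank ≤ l.length := by
  classical
  have h : Ideal.ofList l = Submodule.span R (l.toFinset : Set R) := by
    simp [Ideal.ofList, Ideal.span]
  rw [h]
  refine (Submodule.spanFinrank_span_le_ncard_of_finite (Finset.finite_toSet _)).trans ?_
  rw [Set.ncard_coe_finset]
  exact List.toFinset_card_le l

lemma Ideal.exists_ofList_eq_of_fg {R : Type*} [CommRing R] {I : Ideal R} (hI : I.FG) :
    ∃ l : List R, l.length = I.spanFinrank ∧ Ideal.ofList l = I := by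
  obtain ⟨s, hs, hs'⟩ := Submodule.FG.exists_span_finset_card_eq_spanFinrank hI
  refine ⟨s.toList, by simpa using hs, ?_⟩
  rw [← hs', Ideal.ofList]
  simp [Ideal.span]

variable {R : Type u} [CommRing R] [IsLocalRing R]

lemma isLocalRing_quotient_of_le_maximalIdeal {I : Ideal R} (hI : I ≤ maximalIdeal R) :
    IsLocalRing (R ⧸ I) := by
  have : Nontrivial (R ⧸ I) := Ideal.Quotient.nontrivial_iff.2 fun h =>
    (maximalIdeal.isMaximal R).ne_top (top_le_iff.1 (h ▸ hI))
  exact IsLocalRing.of_surjective' (Ideal.Quotient.mk _) Ideal.Quotient.mk_surjective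

lemma maximalIdeal_quotient_eq_ofList {t : R} [IsLocalRing (R ⧸ Ideal.span {t})] {ts : List R}
    (hts : Ideal.ofList (t :: ts) = maximalIdeal R) :
    maximalIdeal (R ⧸ Ideal.span {t}) =
      Ideal.ofList (ts.map (Ideal.Quotient.mk (Ideal.span {t}))) := by
  rw [← map_maximalIdeal_of_surjective _ (Ideal.Quotient.mk_surjective (I := Ideal.span {t})),
    ← hts, Ideal.map_ofList]
  simp

variable [IsNoetherianRing R]

lemma isRegularLocalRing_quotient_span_singleton {t : R} [IsLocalRing (R ⧸ Ideal.span {t})]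
    {ts : List R} (hts : Ideal.ofList (t :: ts) = maximalIdeal R)
    (hdim : ringKrullDim (R ⧸ Ideal.span {t}) = ts.length) :
    IsRegularLocalRing (R ⧸ Ideal.span {t}) ∧
      (maximalIdeal (R ⧸ Ideal.span {t})).spanFinrank = ts.length := by
  have h1 : (maximalIdeal (R ⧸ Ideal.span {t})).spanFinrank ≤ ts.length := by
    rw [maximalIdeal_quotient_eq_ofList hts]
    refine (Ideal.spanFinrank_ofList_le _).trans ?_
    rw [List.length_map]
  have h2 : IsRegularLocalRing (R ⧸ Ideal.span {t}) :=
    IsRegularLocalRing.of_spanFinrank_maximalIdeal_le _ (by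
      rw [hdim]
      exact_mod_cast h1)
  refine ⟨h2, ?_⟩
  have := h2.spanFinrank_maximalIdeal
  rw [hdim] at this
  exact_mod_cast this

/-- Avoiding minimal primes is used in place of being a nonzerodivisor, because the lemma serves the
proof that regular local rings are domains. -/
lemma ringKrullDim_quotient_add_one_of_notMem_minimalPrimes {t : R} (ht : t ∈ maximalIdeal R)
    (hmin : ∀ P ∈ minimalPrimes R, t ∉ P) :
    ringKrullDim (R ⧸ Ideal.span {t}) + 1 = ringKrullDim R := by
  have h := Module.supportDim_quotSMulTop_succ_eq_of_notMem_minimalPrimes_of_mem_maximalIdeal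
    (M := R) (x := t) (by
      have : Module.annihilator R R = ⊥ := Module.annihilator_eq_bot.2 inferInstance
      rw [this]
      exact hmin) ht
  have h2 : Ideal.span {t} = t • (⊤ : Ideal R) := by
    simp [← Submodule.ideal_span_singleton_smul]
  rw [Module.supportDim_self_eq_ringKrullDim] at h
  rw [← h, ringKrullDim_eq_of_ringEquiv (Ideal.quotientEquivAlgOfEq R h2).toRingEquiv,
    ← Module.supportDim_quotient_eq_ringKrullDim]

/-- An element of the maximal ideal outside its square extends to a minimal generating list. -/
lemma exists_ofList_cons_eq_maximalIdeal {x : R} (hx : x ∈ maximalIdeal R)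
    (hx2 : x ∉ maximalIdeal R ^ 2) :
    ∃ ts : List R, ts.length + 1 = (maximalIdeal R).spanFinrank ∧
      Ideal.ofList (x :: ts) = maximalIdeal R := by
  let V := CotangentSpace R
  let v : V := (maximalIdeal R).toCotangent ⟨x, hx⟩
  have hv : v ≠ 0 := fun h => hx2 (((maximalIdeal R).toCotangent_eq_zero _).1 h)
  let W : Submodule (ResidueField R) V := Submodule.span _ {v}
  have hW : Module.finrank (ResidueField R) W = 1 := finrank_span_singleton hv
  have hQ := Submodule.finrank_quotient_add_finrank W
  rw [hW, ← spanFinrank_maximalIdeal_eq_finrank_cotangentSpace] at hQ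
  let b := Module.finBasis (ResidueField R) (V ⧸ W)
  have hlift : ∀ i, ∃ y : maximalIdeal R, W.mkQ ((maximalIdeal R).toCotangent y) = b i := by
    intro i
    obtain ⟨w, hw⟩ := W.mkQ_surjective (b i)
    obtain ⟨y, rfl⟩ := (maximalIdeal R).toCotangent_surjective w
    exact ⟨y, hw⟩
  choose y hy using hlift
  refine ⟨List.ofFn fun i => (y i : R), by rw [List.length_ofFn]; exact hQ, ?_⟩
  have hmem : ∀ i, (y i : R) ∈ Ideal.ofList (x :: List.ofFn fun i => (y i : R)) := fun i =>
    Ideal.subset_span (List.mem_cons_of_mem _ (List.mem_ofFn.2 ⟨i, rfl⟩))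
  apply le_antisymm
  · rw [Ideal.ofList, Ideal.span_le]
    intro r hr
    rcases List.mem_cons.1 hr with rfl | hr
    · exact hx
    · obtain ⟨i, rfl⟩ := List.mem_ofFn.1 hr
      exact (y i).2
  -- Nakayama: it is enough to generate the maximal ideal modulo its square.
  · refine Submodule.le_of_le_smul_of_le_jacobson_bot (IsNoetherian.noetherian _)
      (maximalIdeal_le_jacobson ⊥) fun z hz => ?_
    obtain ⟨c, hc⟩ : ∃ c : Fin (Module.finrank (ResidueField R) (V ⧸ W)) → R,
        W.mkQ ((maximalIdeal R).toCotangent ⟨z, hz⟩) = ∑ i, residue R (c i) • b i := by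
      choose c hc using fun i =>
        residue_surjective (b.repr (W.mkQ ((maximalIdeal R).toCotangent ⟨z, hz⟩)) i)
      refine ⟨c, ?_⟩
      conv_lhs => rw [← b.sum_repr (W.mkQ ((maximalIdeal R).toCotangent ⟨z, hz⟩))]
      simp only [hc]
    have hsub : (maximalIdeal R).toCotangent ⟨z, hz⟩ -
        ∑ i, residue R (c i) • (maximalIdeal R).toCotangent (y i) ∈ W := by
      refine (Submodule.Quotient.mk_eq_zero W).1 ?_
      change W.mkQ _ = 0
      rw [map_sub, hc, map_sum]
      simp only [map_smul, hy, sub_self]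
    obtain ⟨a, ha⟩ := Submodule.mem_span_singleton.1 hsub
    obtain ⟨a, rfl⟩ := residue_surjective a
    have hcot : (maximalIdeal R).toCotangent
        (⟨z, hz⟩ - ∑ i, c i • y i - a • ⟨x, hx⟩) = 0 := by
      rw [map_sub, map_sub, map_sum]
      simp only [map_smul]
      exact sub_eq_zero.2 ha.symm
    rw [Ideal.toCotangent_eq_zero] at hcot
    have hz' : z = (∑ i, c i * (y i : R) + a * x) + (z - ∑ i, c i * (y i : R) - a * x) := by ring
    rw [hz']
    refine Submodule.add_mem_sup (Ideal.add_mem _ (Ideal.sum_mem _ fun i _ =>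
      Ideal.mul_mem_left _ _ (hmem i)) (Ideal.mul_mem_left _ _
        (Ideal.subset_span (List.mem_cons_self)))) ?_
    rw [smul_eq_mul, ← pow_two]
    convert hcot
    simp

end

/-! ### Regular local rings are domains, with maximal ideal generated by a regular sequence. -/

section
open RingTheory.Sequence
open scoped Pointwise

/-- Choose `x` in the maximal ideal outside its square and all minimal primes. By induction `R/(x)`
is a domain, so `(x)` is prime and contains a minimal prime `q`. As `x ∉ q`, one gets `q = xq`, and
Nakayama gives `q = 0`. -/
lemma IsRegularLocalRing.isDomain_of_spanFinrank_eq (d : ℕ) :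
    ∀ (R : Type u) [CommRing R] [IsRegularLocalRing R],
      (maximalIdeal R).spanFinrank = d → IsDomain R := by
  induction d with
  | zero =>
    intro R _ _ h
    rw [Submodule.spanFinrank_eq_zero_iff_eq_bot (IsNoetherian.noetherian _),
      ← isField_iff_maximalIdeal_eq] at h
    exact h.isDomain
  | succ d ih =>
    intro R _ _ h
    have hdim : ringKrullDim R = (d + 1 : ℕ) := by
      rw [← IsRegularLocalRing.spanFinrank_maximalIdeal, h]
    obtain ⟨x, hx, hx2, hmin⟩ : ∃ x ∈ maximalIdeal R, x ∉ maximalIdeal R ^ 2 ∧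
        ∀ P ∈ minimalPrimes R, x ∉ P := by
      -- Prime avoidance tolerates the one ideal in the family that need not be prime, namely the
      -- square.
      by_contra! hcon
      have hsub : (maximalIdeal R : Set R) ⊆
          ⋃ P ∈ insert (maximalIdeal R ^ 2) (minimalPrimes R), (P : Set R) := fun x hx => by
        by_cases hx2 : x ∈ maximalIdeal R ^ 2
        · exact Set.mem_biUnion (Set.mem_insert _ _) hx2
        · obtain ⟨P, hP, hxP⟩ := hcon x hx hx2
          exact Set.mem_biUnion (Set.mem_insert_of_mem _ hP) hxP
      obtain ⟨P, hP, hle⟩ := (Ideal.subset_union_prime_finite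
        ((minimalPrimes.finite_of_isNoetherianRing R).insert _) (f := id)
        (maximalIdeal R ^ 2) (maximalIdeal R ^ 2) (fun P hP h1 _ => by
          rcases hP with rfl | hP
          · exact absurd rfl h1
          · exact hP.1.1)).1 hsub
      rcases hP with rfl | hP
      · have hbot := Submodule.eq_bot_of_le_smul_of_le_jacobson_bot (maximalIdeal R)
          (maximalIdeal R) (IsNoetherian.noetherian _)
          (by rw [smul_eq_mul, ← pow_two]; exact hle) (maximalIdeal_le_jacobson ⊥)
        rw [← Submodule.spanFinrank_eq_zero_iff_eq_bot (IsNoetherian.noetherian _)] at hbot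
        omega
      · have hPp : P.IsPrime := hP.1.1
        have hPm : P = maximalIdeal R := le_antisymm (le_maximalIdeal hPp.ne_top) hle
        have h0 : (maximalIdeal R).height = 0 := Ideal.height_eq_zero_iff.2 (hPm ▸ hP)
        have h1 := maximalIdeal_height_eq_ringKrullDim (R := R)
        rw [h0, hdim] at h1
        norm_cast at h1
    obtain ⟨ts, hlen, hts⟩ := exists_ofList_cons_eq_maximalIdeal hx hx2
    have hloc : IsLocalRing (R ⧸ Ideal.span {x}) :=
      isLocalRing_quotient_of_le_maximalIdeal ((Ideal.span_singleton_le_iff_mem _).2 hx)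
    have hd : ts.length = d := by omega
    have hdimq : ringKrullDim (R ⧸ Ideal.span {x}) = ts.length := by
      have := ringKrullDim_quotient_add_one_of_notMem_minimalPrimes hx hmin
      rw [hdim, Nat.cast_add, Nat.cast_one] at this
      rw [hd]
      exact ENat.WithBot.add_one_cancel.1 this
    obtain ⟨hreg, hfr⟩ := isRegularLocalRing_quotient_span_singleton hts hdimq
    have hdom : IsDomain (R ⧸ Ideal.span {x}) := ih _ (hfr.trans hd)
    have hprime : (Ideal.span {x}).IsPrime := (Ideal.Quotient.isDomain_iff_prime _).1 hdom
    obtain ⟨q, hq, hqx⟩ := Ideal.exists_minimalPrimes_le (bot_le (a := Ideal.span {x}))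
    have hqp : q.IsPrime := hq.1.1
    have hxq : x ∉ q := hmin q hq
    have hq0 : q = ⊥ := by
      refine Submodule.eq_bot_of_le_smul_of_le_jacobson_bot (Ideal.span {x}) q
        (IsNoetherian.noetherian _) (fun z hz => ?_)
        (((Ideal.span_singleton_le_iff_mem _).2 hx).trans (maximalIdeal_le_jacobson ⊥))
      obtain ⟨w, rfl⟩ := Ideal.mem_span_singleton'.1 (hqx hz)
      rw [mul_comm]
      exact Submodule.smul_mem_smul (Ideal.mem_span_singleton_self x)
        ((hqp.mem_or_mem hz).resolve_right hxq)
    have : (⊥ : Ideal R).IsPrime := hq0 ▸ hqp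
    exact IsDomain.of_bot_isPrime R

instance IsRegularLocalRing.isDomain (R : Type u) [CommRing R] [IsRegularLocalRing R] :
    IsDomain R :=
  isDomain_of_spanFinrank_eq _ R rfl

lemma IsRegularLocalRing.isWeaklyRegular_of_ofList_eq_maximalIdeal (d : ℕ) :
    ∀ (R : Type u) [CommRing R] [IsRegularLocalRing R],
      (maximalIdeal R).spanFinrank = d → ∀ ts : List R, ts.length = d →
        Ideal.ofList ts = maximalIdeal R → IsWeaklyRegular R ts := by
  induction d with
  | zero =>
    intro R _ _ h ts hlen hts
    rw [List.length_eq_zero_iff.1 hlen]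
    exact IsWeaklyRegular.nil R R
  | succ d ih =>
    intro R _ _ h ts hlen hts
    match ts with
    | [] => simp at hlen
    | t :: ts =>
      have hlen : ts.length = d := by simpa using hlen
      have hdim : ringKrullDim R = (d + 1 : ℕ) := by
        rw [← IsRegularLocalRing.spanFinrank_maximalIdeal, h]
      have ht : t ∈ maximalIdeal R := hts ▸ Ideal.subset_span List.mem_cons_self
      -- Were `t` zero, the remaining `d` elements would generate an ideal needing `d + 1`
      -- generators.
      have ht0 : t ≠ 0 := by
        rintro rfl
        have h1 := Ideal.spanFinrank_ofList_le ts
        have h2 : Ideal.ofList ts = maximalIdeal R := by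
          rw [← hts, Ideal.ofList_cons]
          simp
        rw [h2] at h1
        omega
      have hreg : IsSMulRegular R t := fun a b hab => mul_left_cancel₀ ht0 hab
      have hloc : IsLocalRing (R ⧸ Ideal.span {t}) :=
        isLocalRing_quotient_of_le_maximalIdeal ((Ideal.span_singleton_le_iff_mem _).2 ht)
      have hdimq : ringKrullDim (R ⧸ Ideal.span {t}) = ts.length := by
        have := ringKrullDim_quotient_span_singleton_succ_eq_ringKrullDim hreg ht
        rw [hdim, Nat.cast_add, Nat.cast_one] at this
        rw [hlen]
        exact ENat.WithBot.add_one_cancel.1 this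
      obtain ⟨hregq, hfr⟩ := isRegularLocalRing_quotient_span_singleton hts hdimq
      have hq := ih (R ⧸ Ideal.span {t}) (hfr.trans hlen)
        (ts.map (algebraMap R (R ⧸ Ideal.span {t}))) (by rw [List.length_map, hlen])
        (maximalIdeal_quotient_eq_ofList hts).symm
      rw [isWeaklyRegular_map_algebraMap_iff] at hq
      rw [isWeaklyRegular_cons_iff]
      refine ⟨hreg, ?_⟩
      have h2 : Ideal.span {t} = t • (⊤ : Ideal R) := by
        simp [← Submodule.ideal_span_singleton_smul]
      exact ((Submodule.quotEquivOfEq _ _ h2).isWeaklyRegular_congr ts).1 hq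

lemma IsRegularLocalRing.exists_isRegular_ofList_eq_maximalIdeal (R : Type u) [CommRing R]
    [IsRegularLocalRing R] :
    ∃ ts : List R, ts.length = (maximalIdeal R).spanFinrank ∧
      Ideal.ofList ts = maximalIdeal R ∧ IsRegular R ts := by
  obtain ⟨ts, hlen, hts⟩ := Ideal.exists_ofList_eq_of_fg
    (IsNoetherian.noetherian (maximalIdeal R))
  refine ⟨ts, hlen, hts, IsRegular.of_isWeaklyRegular_of_mem_maximalIdeal R
    (fun r hr => hts ▸ Ideal.subset_span hr)
    (isWeaklyRegular_of_ofList_eq_maximalIdeal _ R rfl ts hlen hts)⟩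

end

/-! ### Sequences that lower the dimension by their length in a Cohen–Macaulay module. -/

section
open CategoryTheory.Abelian RingTheory.Sequence
open scoped Pointwise

variable {R : Type u} [CommRing R] [IsNoetherianRing R] [IsLocalRing R]

/-- Let `U` be the elements killed by `P`. If `U ⊆ xM`, regularity of `x` gives `U = xU`, so `U = 0`
by Nakayama, which is absurd. An element of `U` outside `xM` has a nonzero class killed by `P` and
`x`, and its annihilator lies in an associated prime. -/
lemma exists_isAssociatedPrime_quotSMulTop {M : Type*} [AddCommGroup M] [Module R M]
    [Module.Finite R M] {x : R} (hx : x ∈ maximalIdeal R) (hreg : IsSMulRegular M x)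
    {P : Ideal R} (hP : IsAssociatedPrime P M) :
    ∃ Q : Ideal R, IsAssociatedPrime Q (QuotSMulTop x M) ∧ P ≤ Q ∧ x ∈ Q := by
  obtain ⟨hPp, y, hy⟩ := isAssociatedPrime_iff.1 hP
  let U : Submodule R M :=
    { carrier := {z | ∀ a ∈ P, a • z = 0}
      add_mem' := fun hz hw a ha => by rw [smul_add, hz a ha, hw a ha, add_zero]
      zero_mem' := fun a _ => smul_zero a
      smul_mem' := fun c z hz a ha => by rw [smul_comm, hz a ha, smul_zero] }
  have hyU : y ∈ U := fun a ha => by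
    rw [hy, Submodule.mem_colon_singleton] at ha
    exact ha
  have hy0 : y ≠ 0 := by
    rintro rfl
    apply hPp.ne_top
    rw [hy]
    simp
  obtain ⟨u, hu, hux⟩ : ∃ u ∈ U, u ∉ x • (⊤ : Submodule R M) := by
    by_contra! hcon
    refine hy0 ((Submodule.eq_bot_iff U).1 (Submodule.eq_bot_of_le_smul_of_le_jacobson_bot
      (Ideal.span {x}) U (IsNoetherian.noetherian _) (fun z hz => ?_)
      (((Ideal.span_singleton_le_iff_mem _).2 hx).trans (maximalIdeal_le_jacobson ⊥))) y hyU)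
    obtain ⟨w, -, rfl⟩ := (Submodule.mem_smul_pointwise_iff_exists _ _ _).1 (hcon z hz)
    refine Submodule.smul_mem_smul (Ideal.mem_span_singleton_self x) fun a ha => hreg ?_
    have := hz a ha
    rw [smul_comm] at this
    simpa using this
  obtain ⟨Q, hQ, hle⟩ := exists_le_isAssociatedPrime_of_isNoetherianRing R
    (Submodule.Quotient.mk u : QuotSMulTop x M) fun h => hux ((Submodule.Quotient.mk_eq_zero _).1 h)
  refine ⟨Q, hQ, fun a ha => hle ?_, hle ?_⟩
  · rw [Submodule.mem_colon_singleton, ← Submodule.Quotient.mk_smul, hu a ha]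
    exact Submodule.zero_mem _
  · rw [Submodule.mem_colon_singleton, ← Submodule.Quotient.mk_smul, Submodule.mem_bot,
      Submodule.Quotient.mk_eq_zero]
    exact Submodule.smul_mem_pointwise_smul _ _ _ trivial

/-- Depth is at most `dim R/P` for each associated `P`: passing to `M/xM` enlarges `P` to some `Q`
containing `x ∉ P`, which costs at least one dimension. -/
lemma length_le_ringKrullDim_quotient_of_isAssociatedPrime (rs : List R) :
    ∀ (M : Type u) [AddCommGroup M] [Module R M] [Module.Finite R M],
      (∀ r ∈ rs, r ∈ maximalIdeal R) → IsWeaklyRegular M rs →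
      ∀ P : Ideal R, IsAssociatedPrime P M → (rs.length : WithBot ℕ∞) ≤ ringKrullDim (R ⧸ P) := by
  induction rs with
  | nil =>
    intro M _ _ _ _ _ P hP
    have := hP.isPrime
    simpa using ringKrullDim_nonneg_of_nontrivial (R := R ⧸ P)
  | cons x rs ih =>
    intro M _ _ _ hmem hrs P hP
    rw [isWeaklyRegular_cons_iff] at hrs
    obtain ⟨Q, hQ, hPQ, hxQ⟩ := exists_isAssociatedPrime_quotSMulTop
      (hmem x List.mem_cons_self) hrs.1 hP
    have hPp := hP.isPrime
    have hxP : x ∉ P := fun hxP => by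
      obtain ⟨-, y, hy⟩ := isAssociatedPrime_iff.1 hP
      rw [hy, Submodule.mem_colon_singleton] at hxP
      have hy0 : y = 0 := hrs.1 (by simpa using hxP)
      apply hPp.ne_top
      rw [hy, hy0]
      simp
    have h1 := ih (QuotSMulTop x M) (fun r hr => hmem r (List.mem_cons_of_mem _ hr)) hrs.2 Q hQ
    have h2 := ringKrullDim_succ_le_of_surjective (Ideal.Quotient.factor hPQ)
      (Ideal.Quotient.factor_surjective hPQ) (r := Ideal.Quotient.mk P x)
      (mem_nonZeroDivisors_of_ne_zero fun h => hxP (Ideal.Quotient.eq_zero_iff_mem.1 h))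
      (by rw [Ideal.Quotient.factor_mk]; exact Ideal.Quotient.eq_zero_iff_mem.2 hxQ)
    rw [List.length_cons, Nat.cast_add, Nat.cast_one]
    exact (add_le_add_left h1 1).trans h2

/-- In a finite module whose depth is at least its dimension `gs.length + c`, a sequence in the
maximal ideal which lowers the dimension by its length is weakly regular. -/
lemma isWeaklyRegular_of_supportDim_le (gs : List R) :
    ∀ (M : ModuleCat.{u} R) [Module.Finite R M] (c : ℕ), (∀ r ∈ gs, r ∈ maximalIdeal R) →
      (∀ i < gs.length + c,
        Subsingleton (Ext.{u} (ModuleCat.of R (R ⧸ maximalIdeal R)) M i)) →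
      Module.supportDim R (M ⧸ Ideal.ofList gs • (⊤ : Submodule R M)) ≤ c →
      IsWeaklyRegular M gs := by
  induction gs with
  | nil => exact fun M _ c _ _ _ => IsWeaklyRegular.nil R M
  | cons g gs ih =>
    intro M _ c hmem hext hdim
    have hdim' : Module.supportDim R (QuotSMulTop g M ⧸
        Ideal.ofList gs • (⊤ : Submodule R (QuotSMulTop g M))) ≤ c := by
      rwa [← Module.supportDim_eq_of_equiv
        (Submodule.quotOfListConsSMulTopEquivQuotSMulTopInner M g gs)]
    -- Each element lowers the dimension by at most one, so `M/gM` has dimension at most `gs.length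
    -- + c`.
    have hbound : ∀ (gs : List R) (N : Type u) [AddCommGroup N] [Module R N] [Module.Finite R N],
        (∀ r ∈ gs, r ∈ maximalIdeal R) → Module.supportDim R N ≤
          Module.supportDim R (N ⧸ Ideal.ofList gs • (⊤ : Submodule R N)) + gs.length := by
      intro gs
      induction gs with
      | nil =>
        intro N _ _ _ _
        rw [Ideal.ofList_nil, Submodule.bot_smul]
        simpa using (Module.supportDim_eq_of_equiv (Submodule.quotEquivOfEqBot ⊥ rfl)).ge
      | cons x rs ih =>
        intro N _ _ _ hmem
        have h1 := Module.supportDim_le_supportDim_quotSMulTop_succ (M := N)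
          (hmem x List.mem_cons_self)
        have h2 := ih (QuotSMulTop x N) (fun r hr => hmem r (List.mem_cons_of_mem _ hr))
        rw [Module.supportDim_eq_of_equiv
          (Submodule.quotOfListConsSMulTopEquivQuotSMulTopInner N x rs), List.length_cons,
          Nat.cast_add, Nat.cast_one, ← add_assoc]
        exact h1.trans (add_le_add_left h2 1)
    have hdimg : Module.supportDim R (QuotSMulTop g M) ≤ (gs.length + c : ℕ) := by
      refine (hbound gs (QuotSMulTop g M) fun r hr => hmem r (List.mem_cons_of_mem _ hr)).trans ?_
      rw [Nat.cast_add, add_comm]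
      exact add_le_add_right hdim' _
    have hreg : IsSMulRegular M g := by
      by_cases hM : Subsingleton M
      · exact fun a b _ => Subsingleton.elim a b
      rw [not_subsingleton_iff_nontrivial] at hM
      obtain ⟨rs, hlen, hrs, hrsreg⟩ := ModuleCat.exists_isRegular_of_exists_subsingleton_ext
        (maximalIdeal R) (gs.length + 1 + c) M
        (lt_top_iff_ne_top.2 (Submodule.top_ne_ideal_smul_of_le_jacobson_annihilator
          (maximalIdeal_le_jacobson _)).symm)
        (ModuleCat.of R (R ⧸ maximalIdeal R))
        (by
          change Module.support R (R ⧸ maximalIdeal R) = _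
          rw [Module.support_eq_zeroLocus, Ideal.annihilator_quotient])
        (by simpa using hext)
      -- A zero divisor `g` lies in some associated prime `P`. Then `dim R/P` is at least the depth
      -- bound `gs.length + 1 + c`, yet `V(P)` lies in the support of `M/gM`, which has smaller
      -- dimension.
      by_contra hnreg
      have hg : g ∈ ⋃ P ∈ associatedPrimes R M, (P : Set R) := by
        rw [biUnion_associatedPrimes_eq_zero_divisors]
        simp only [IsSMulRegular, Function.Injective, not_forall] at hnreg
        obtain ⟨a, b, hab, hne⟩ := hnreg
        exact ⟨a - b, sub_ne_zero.2 hne, by rw [smul_sub]; exact sub_eq_zero.2 hab⟩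
      obtain ⟨P, hP, hgP⟩ := Set.mem_iUnion₂.1 hg
      have h1 := length_le_ringKrullDim_quotient_of_isAssociatedPrime rs M hrs
        hrsreg.toIsWeaklyRegular P hP
      have hPp : P.IsPrime := IsAssociatedPrime.isPrime hP
      obtain ⟨-, F, hF⟩ := (isAssociatedPrime_iff_exists_injective_linearMap P M).1 hP
      have hPM : (⟨P, hPp⟩ : PrimeSpectrum R) ∈ Module.support R M := by
        refine Module.support_subset_of_injective F hF ?_
        rw [Module.support_eq_zeroLocus, Ideal.annihilator_quotient]
        exact fun _ h => h
      have h2 : ringKrullDim (R ⧸ P) ≤ Module.supportDim R (QuotSMulTop g M) := by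
        rw [ringKrullDim_quotient, Module.supportDim]
        refine Order.krullDim_le_of_strictMono (fun a => ⟨a.1, ?_⟩) fun _ _ h => h
        rw [Module.support_quotSMulTop]
        exact ⟨Module.mem_support_mono (p := ⟨P, hPp⟩) a.2 hPM,
          fun y hy => by rw [Set.mem_singleton_iff.1 hy]; exact a.2 hgP⟩
      have h3 := (h1.trans h2).trans hdimg
      rw [hlen] at h3
      norm_cast at h3
      omega
    rw [isWeaklyRegular_cons_iff]
    refine ⟨hreg, ih (ModuleCat.of R (QuotSMulTop g M)) c
      (fun r hr => hmem r (List.mem_cons_of_mem _ hr)) (fun i hi => ?_) hdim'⟩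
    have zero1 := AddCommGrpCat.isZero_of_iff_subsingleton.mpr
      (hext i (by rw [List.length_cons]; omega))
    have zero2 := AddCommGrpCat.isZero_of_iff_subsingleton.mpr
      (hext (i + 1) (by rw [List.length_cons]; omega))
    exact AddCommGrpCat.subsingleton_of_isZero <| ShortComplex.Exact.isZero_of_both_zeros
      ((Ext.covariant_sequence_exact₃' _ hreg.smulShortComplex_shortExact) i (i + 1) rfl)
      (zero1.eq_zero_of_src _) (zero2.eq_zero_of_tgt _)

lemma IsRegularLocalRing.isRegular_of_ringKrullDim_add_length_eq {T : Type u} [CommRing T]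
    [IsRegularLocalRing T] {gs : List T} (hmem : ∀ g ∈ gs, g ∈ maximalIdeal T)
    (hdim : ringKrullDim (T ⧸ Ideal.ofList gs) + gs.length = ringKrullDim T) :
    IsRegular T gs := by
  obtain ⟨ts, hlen, hts, htsreg⟩ := exists_isRegular_ofList_eq_maximalIdeal T
  have hd := spanFinrank_maximalIdeal (R := T)
  have hle : Ideal.ofList gs ≤ maximalIdeal T := Ideal.span_le.2 hmem
  have := isLocalRing_quotient_of_le_maximalIdeal hle
  obtain ⟨c, hc⟩ : ∃ c : ℕ, ringKrullDim (T ⧸ Ideal.ofList gs) = c := by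
    have := isNoetherianRing_of_surjective _ _ (Ideal.Quotient.mk (Ideal.ofList gs))
      Ideal.Quotient.mk_surjective
    exact ⟨_, (WithBot.coe_unbot _ ringKrullDim_ne_bot).symm.trans
      (congrArg _ (ENat.natCast_toNat (by simpa [WithBot.unbot_eq_iff] using ringKrullDim_ne_top)).symm)⟩
  rw [hc, ← hd, ← hlen] at hdim
  norm_cast at hdim
  refine IsRegular.of_isWeaklyRegular_of_mem_maximalIdeal T hmem
    (isWeaklyRegular_of_supportDim_le gs (ModuleCat.of T T) c hmem (fun i hi => ?_) ?_)
  · have h := extSelfConcentrated_quotient_ofList (R := T) htsreg.toIsWeaklyRegular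
    rw [hts] at h
    exact h.1 i (by omega)
  · have h2 : Ideal.ofList gs • (⊤ : Submodule T T) = Ideal.ofList gs := by simp
    change Module.supportDim T (T ⧸ Ideal.ofList gs • (⊤ : Submodule T T)) ≤ c
    rw [h2, Module.supportDim_quotient_eq_ringKrullDim, hc]

end

/-! ### First Koszul homology and the number of generators of a kernel. -/

section
open RingTheory.Sequence

section Koszul

variable {R : Type*} [CommRing R] {F G : Type*} [AddCommGroup F] [Module R F] [AddCommGroup G]
  [Module R G]

/-- The trivial syzygies `φ a • b - φ b • a` of a linear form `φ`. -/
def koszulSyzygies (φ : F →ₗ[R] R) : Submodule R F :=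
  Submodule.span R {z | ∃ a b : F, z = φ a • b - φ b • a}

lemma smul_sub_smul_mem_koszulSyzygies (φ : F →ₗ[R] R) (a b : F) :
    φ a • b - φ b • a ∈ koszulSyzygies φ :=
  Submodule.subset_span ⟨a, b, rfl⟩

/-- The first Koszul homology of a linear form. -/
abbrev KoszulH1 (φ : F →ₗ[R] R) : Type _ :=
  LinearMap.ker φ ⧸ (koszulSyzygies φ).submoduleOf (LinearMap.ker φ)

lemma koszulSyzygies_le_comap {φ : F →ₗ[R] R} {ψ : G →ₗ[R] R} (e : F →ₗ[R] G)
    (h : ∀ a, ψ (e a) = φ a) : koszulSyzygies φ ≤ (koszulSyzygies ψ).comap e := by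
  refine Submodule.span_le.2 ?_
  rintro _ ⟨a, b, rfl⟩
  change e _ ∈ koszulSyzygies ψ
  rw [map_sub, map_smul, map_smul, ← h a, ← h b]
  exact smul_sub_smul_mem_koszulSyzygies ψ _ _

lemma length_koszulH1_congr {φ : F →ₗ[R] R} {ψ : G →ₗ[R] R} (e : F ≃ₗ[R] G)
    (h : ∀ a, ψ (e a) = φ a) :
    Module.length R (KoszulH1 φ) = Module.length R (KoszulH1 ψ) := by
  have h' : ∀ a, φ (e.symm a) = ψ a := fun a => by rw [← h, e.apply_symm_apply]
  let e' : LinearMap.ker φ ≃ₗ[R] LinearMap.ker ψ :=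
    e.ofSubmodules _ _ (by
      ext x
      rw [Submodule.mem_map_equiv, LinearMap.mem_ker, LinearMap.mem_ker, h'])
  refine (Submodule.Quotient.equiv _ _ e' ?_).length_eq
  ext x
  rw [Submodule.mem_map_equiv]
  constructor
  · intro hx
    have := koszulSyzygies_le_comap e.toLinearMap h hx
    change e (e.symm x) ∈ koszulSyzygies ψ at this
    rwa [e.apply_symm_apply] at this
  · intro hx
    exact koszulSyzygies_le_comap e.symm.toLinearMap h' hx

/-- Since `ψ` lifts through `φ` as `φ ∘ γ`, the shear `(x, g) ↦ (x + γ g, g)` reduces to `ψ = 0`.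
Then every basis vector of the second factor is a syzygy, and the trivial syzygies contain exactly
its multiples by `m`. -/
lemma length_koszulH1_coprod {m : Ideal R} {φ : F →ₗ[R] R} {b : ℕ} {ψ : (Fin b → R) →ₗ[R] R}
    (hφ : LinearMap.range φ = m) (hψ : LinearMap.range ψ ≤ m) :
    Module.length R (KoszulH1 (φ.coprod ψ)) =
      Module.length R (KoszulH1 φ) + b * Module.length R (R ⧸ m) := by
  choose w hw using fun i => hφ.ge (hψ (LinearMap.mem_range_self ψ (Pi.single i 1)))
  let γ : (Fin b → R) →ₗ[R] F := Fintype.linearCombination R w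
  have hγ : ∀ g, φ (γ g) = ψ g := by
    intro g
    have : φ ∘ₗ γ = ψ := by
      ext i
      simp [γ, hw]
    exact LinearMap.congr_fun this g
  let sh : F × (Fin b → R) →ₗ[R] F := LinearMap.id.coprod γ
  have hsh : ∀ x, φ (sh x) = φ.coprod ψ x := fun x => by simp [sh, hγ]
  let σ : LinearMap.ker (φ.coprod ψ) →ₗ[R] LinearMap.ker φ :=
    sh.restrict fun x hx => by rw [LinearMap.mem_ker, hsh]; exact hx
  let q : (Fin b → R) →ₗ[R] (Fin b → R ⧸ m) := LinearMap.pi fun i => m.mkQ ∘ₗ LinearMap.proj i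
  let Φ : LinearMap.ker (φ.coprod ψ) →ₗ[R] KoszulH1 φ × (Fin b → R ⧸ m) :=
    (Submodule.mkQ _ ∘ₗ σ).prod (q ∘ₗ LinearMap.snd R F _ ∘ₗ Submodule.subtype _)
  have hΦ : Function.Surjective Φ := by
    rintro ⟨x, y⟩
    obtain ⟨⟨x, hx⟩, rfl⟩ := Submodule.mkQ_surjective _ x
    choose z hz using fun i => m.mkQ_surjective (y i)
    refine ⟨⟨(x - γ z, z), ?_⟩, ?_⟩
    · rw [LinearMap.mem_ker] at hx ⊢
      simp [hγ, hx]
    · refine Prod.ext (congrArg (Submodule.mkQ _) (Subtype.ext ?_)) (funext hz)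
      change x - γ z + γ z = x
      simp
  have hker : LinearMap.ker Φ =
      (koszulSyzygies (φ.coprod ψ)).submoduleOf (LinearMap.ker (φ.coprod ψ)) := by
    have hmem : ∀ x, x ∈ LinearMap.ker Φ ↔
        sh x.1 ∈ koszulSyzygies φ ∧ ∀ i, x.1.2 i ∈ m := by
      intro x
      rw [LinearMap.mem_ker, Prod.ext_iff, funext_iff]
      exact and_congr (Submodule.Quotient.mk_eq_zero _)
        (forall_congr' fun i => Submodule.Quotient.mk_eq_zero _)
    ext ⟨⟨x, g⟩, hx⟩
    rw [hmem]
    change _ ↔ (x, g) ∈ koszulSyzygies (φ.coprod ψ)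
    constructor
    · rintro ⟨h1, h2⟩
      have h3 : (sh (x, g), (0 : Fin b → R)) ∈ koszulSyzygies (φ.coprod ψ) :=
        koszulSyzygies_le_comap (LinearMap.inl R F (Fin b → R)) (by simp) h1
      have h4 : (-γ g, g) = ∑ i, g i • (-γ (Pi.single i 1), (Pi.single i 1 : Fin b → R)) := by
        have : ((-γ).prod LinearMap.id) g =
            ∑ i, g i • ((-γ).prod LinearMap.id) (Pi.single i (1 : R)) := by
          conv_lhs => rw [pi_eq_sum_univ' g]
          rw [map_sum]
          simp only [map_smul]
        exact this
      have h5 : (x, g) = (sh (x, g), (0 : Fin b → R)) + (-γ g, g) := by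
        refine Prod.ext ?_ ?_
        · change x = x + γ g + -γ g
          simp
        · simp
      rw [h5]
      refine add_mem h3 ?_
      rw [h4]
      refine Submodule.sum_mem _ fun i _ => ?_
      obtain ⟨a, ha⟩ := hφ.ge (h2 i)
      -- Since `(-γ e_i, e_i)` is a syzygy, its trivial relation with a vector on which `φ` equals
      -- `g i` is `g i` times it.
      have h6 := smul_sub_smul_mem_koszulSyzygies (φ.coprod ψ) (a, 0)
        (-γ (Pi.single i 1), (Pi.single i 1 : Fin b → R))
      simpa [hγ, ha] using h6
    · intro h1
      refine ⟨koszulSyzygies_le_comap sh hsh h1, fun i => ?_⟩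
      have hr : ∀ y, φ.coprod ψ y ∈ m := fun y => by
        rw [LinearMap.coprod_apply]
        exact add_mem (hφ.le ⟨_, rfl⟩) (hψ ⟨_, rfl⟩)
      have : koszulSyzygies (φ.coprod ψ) ≤
          Submodule.comap (LinearMap.proj i ∘ₗ LinearMap.snd R F (Fin b → R)) m := by
        refine Submodule.span_le.2 ?_
        rintro _ ⟨a, b, rfl⟩
        exact sub_mem (Ideal.mul_mem_right _ _ (hr _)) (Ideal.mul_mem_right _ _ (hr _))
      exact this h1
  rw [← (Submodule.quotEquivOfEq _ _ hker).length_eq,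
    (LinearMap.quotKerEquivOfSurjective Φ hΦ).length_eq, Module.length_prod,
    Module.length_pi]
  simp

/-- Both sides compute the homology of the concatenated list, in either order. -/
lemma length_koszulH1_add_eq {m : Ideal R} {a b : ℕ} {φ : (Fin a → R) →ₗ[R] R}
    {ψ : (Fin b → R) →ₗ[R] R} (hφ : LinearMap.range φ = m) (hψ : LinearMap.range ψ = m) :
    Module.length R (KoszulH1 φ) + b * Module.length R (R ⧸ m) =
      Module.length R (KoszulH1 ψ) + a * Module.length R (R ⧸ m) := by
  rw [← length_koszulH1_coprod hφ hψ.le, ← length_koszulH1_coprod hψ hφ.le]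
  exact length_koszulH1_congr (LinearEquiv.prodComm R _ _) fun x => by simp [add_comm]

/-- First Koszul homology of a regular sequence vanishes. In a relation supported on the first `j +
1` places, regularity puts the last coefficient in the ideal of the earlier elements, and a trivial
syzygy removes it. -/
lemma ker_linearCombination_le_koszulSyzygies {d : ℕ} {t : Fin d → R}
    (ht : IsWeaklyRegular R (List.ofFn t)) :
    LinearMap.ker (Fintype.linearCombination R t) ≤
      koszulSyzygies (Fintype.linearCombination R t) := by
  set τ := Fintype.linearCombination R t with hτ
  have hsingle : ∀ i, τ (Pi.single i 1) = t i := fun i => by simp [τ]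
  have key : ∀ j ≤ d, ∀ a : Fin d → R, (∀ i : Fin d, j ≤ i → a i = 0) → τ a = 0 →
      a ∈ koszulSyzygies τ := by
    intro j
    induction j with
    | zero =>
      intro _ a ha _
      rw [show a = 0 from funext fun i => ha i (Nat.zero_le _)]
      exact zero_mem _
    | succ j ih =>
      intro hj a ha hτa
      have htake : Ideal.ofList ((List.ofFn t).take j) ≤
          Submodule.map τ {
            carrier := {b : Fin d → R | ∀ i : Fin d, j ≤ i → b i = 0}
            add_mem' := fun hb hc i hi => by simp [hb i hi, hc i hi]
            zero_mem' := fun _ _ => rfl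
            smul_mem' := fun c b hb i hi => by simp [hb i hi] } := by
        refine Ideal.span_le.2 fun r hr => ?_
        obtain ⟨i, hi, rfl⟩ := List.mem_take_iff_getElem.1 hr
        rw [List.length_ofFn] at hi
        refine ⟨Pi.single ⟨i, by omega⟩ 1, fun k hk => ?_, by simp [hsingle]⟩
        refine Pi.single_eq_of_ne (fun h => ?_) _
        subst h
        change j ≤ i at hk
        omega
      let j' : Fin d := ⟨j, hj⟩
      have hmap : ∀ b : Fin d → R, (∀ i : Fin d, j ≤ i → b i = 0) →
          τ b ∈ Ideal.ofList ((List.ofFn t).take j) := by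
        intro b hb
        rw [hτ, Fintype.linearCombination_apply]
        refine Ideal.sum_mem _ fun i _ => ?_
        by_cases hi : j ≤ i
        · simp [hb i hi]
        · refine Ideal.mul_mem_left _ _ (Ideal.subset_span ?_)
          refine List.mem_take_iff_getElem.2 ⟨i, ?_, by simp⟩
          rw [List.length_ofFn]
          omega
      have haj : a j' ∈ Ideal.ofList ((List.ofFn t).take j) := by
        have h1 := ht.regular_mod_prev j (by rw [List.length_ofFn]; omega)
        have h2 : t j' * a j' ∈ Ideal.ofList ((List.ofFn t).take j) := by
          have h3 := hmap (a - a j' • Pi.single j' 1) fun i hi => by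
            by_cases hij : i = j'
            · subst hij
              simp
            · rw [Pi.sub_apply, Pi.smul_apply, Pi.single_eq_of_ne hij, ha i ?_]
              · simp
              · have : (i : ℕ) ≠ j := fun h => hij (Fin.ext h)
                omega
          rw [map_sub, map_smul, hsingle, hτa, zero_sub, smul_eq_mul, mul_comm] at h3
          exact neg_mem_iff.1 h3
        have h4 : Ideal.ofList ((List.ofFn t).take j) • (⊤ : Submodule R R) =
            Ideal.ofList ((List.ofFn t).take j) := by simp
        rw [h4, List.getElem_ofFn] at h1
        rw [← Submodule.Quotient.mk_eq_zero]
        refine h1 ?_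
        change t j' • Submodule.Quotient.mk (a j') = t j' • 0
        rw [smul_zero, ← Submodule.Quotient.mk_smul, Submodule.Quotient.mk_eq_zero]
        exact h2
      obtain ⟨b, hb, hbj⟩ := htake haj
      have hb : ∀ i : Fin d, j ≤ i → b i = 0 := hb
      have hsplit : a = (a - (τ b • Pi.single j' 1 - τ (Pi.single j' 1) • b)) +
          (τ b • Pi.single j' 1 - τ (Pi.single j' 1) • b) := by simp
      rw [hsplit]
      refine add_mem (ih (by omega) _ (fun i hi => ?_) ?_)
        (smul_sub_smul_mem_koszulSyzygies τ _ _)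
      · by_cases hij : i = j'
        · subst hij
          simp [hbj, hb j' le_rfl]
        · have h7 : a i = 0 := ha i (by
            have : (i : ℕ) ≠ j := fun h => hij (Fin.ext h)
            omega)
          simp [h7, hb i hi, Pi.single_eq_of_ne hij]
      · rw [map_sub, map_sub, map_smul, map_smul, hτa, smul_eq_mul, smul_eq_mul]
        ring
  exact fun a ha => key d le_rfl a (fun i hi => absurd i.2 (by omega)) ha

/-- Both sides measure `Tor_1^A(A/m, R) = I/mI`. Concretely, the vectors `a` over `A` with `τ a ∈ I`
surject onto the Koszul homology over `R` and onto `I/mI`, with the same kernel. -/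
lemma length_koszulH1_eq_spanFinrank_ker {A R : Type*} [CommRing A] [IsLocalRing A]
    [IsNoetherianRing A] [CommRing R] [Nontrivial R] {π : A →+* R} (hπ : Function.Surjective π)
    {d : ℕ} {t : Fin d → A} (ht : IsWeaklyRegular A (List.ofFn t))
    (hm : Ideal.ofList (List.ofFn t) = maximalIdeal A) :
    Module.length R (KoszulH1 (Fintype.linearCombination R fun i => π (t i))) =
      (RingHom.ker π).spanFinrank := by
  algebraize [π]
  have hπ' : ∀ x, algebraMap A R x = π x := fun x => rfl
  set I := RingHom.ker π
  set τ := Fintype.linearCombination A t with hτ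
  set φ := Fintype.linearCombination R fun i => π (t i) with hφ
  have hrange : LinearMap.range τ = maximalIdeal A := by
    rw [hτ, Fintype.range_linearCombination, ← hm, Ideal.ofList, Ideal.span]
    congr 1
    ext x
    simp [List.mem_ofFn]
  let μ : (Fin d → A) →ₗ[A] (Fin d → R) :=
    LinearMap.pi fun i => Algebra.linearMap A R ∘ₗ LinearMap.proj i
  have hμ : ∀ a i, μ a i = π (a i) := fun a i => rfl
  have hφμ : ∀ a, φ (μ a) = π (τ a) := fun a => by
    simp [hφ, hτ, Fintype.linearCombination_apply, hμ]
  have hμs : Function.Surjective μ := fun b => by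
    choose a ha using fun i => hπ (b i)
    exact ⟨a, funext ha⟩
  let K : Submodule A (Fin d → A) := Submodule.comap τ I
  have hIm : I ≤ maximalIdeal A := le_maximalIdeal (RingHom.ker_ne_top π)
  let ρ : K →ₗ[A] KoszulH1 φ :=
    (Submodule.mkQ _).restrictScalars A ∘ₗ
      LinearMap.restrict (q := (LinearMap.ker φ).restrictScalars A) μ fun a ha => by
        change φ (μ a) = 0
        rw [hφμ]
        exact ha
  let σ : K →ₗ[A] I ⧸ (maximalIdeal A • ⊤ : Submodule A I) :=
    Submodule.mkQ _ ∘ₗ τ.restrict (fun _ ha => ha)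
  have hρmem : ∀ x, x ∈ LinearMap.ker ρ ↔ μ x.1 ∈ koszulSyzygies φ := fun x =>
    Submodule.Quotient.mk_eq_zero _
  have hσmem : ∀ x, x ∈ LinearMap.ker σ ↔ τ x.1 ∈ maximalIdeal A * I := by
    intro x
    refine (Submodule.Quotient.mk_eq_zero _).trans ?_
    rw [Submodule.mem_smul_top_iff]
    exact Iff.rfl
  have hρs : Function.Surjective ρ := by
    intro y
    obtain ⟨⟨y, hy⟩, rfl⟩ := Submodule.mkQ_surjective _ y
    obtain ⟨a, rfl⟩ := hμs y
    refine ⟨⟨a, ?_⟩, rfl⟩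
    change π (τ a) = 0
    rw [← hφμ]
    exact hy
  have hσs : Function.Surjective σ := by
    intro y
    obtain ⟨⟨y, hy⟩, rfl⟩ := Submodule.mkQ_surjective _ y
    obtain ⟨a, rfl⟩ := hrange.ge (hIm hy)
    exact ⟨⟨a, hy⟩, rfl⟩
  have hker : LinearMap.ker ρ = LinearMap.ker σ := by
    ext ⟨a, haK⟩
    rw [hρmem, hσmem]
    constructor
    · intro ha
      -- Trivial syzygies lift to trivial syzygies, where `τ` vanishes; two lifts differ by a vector
      -- with entries in `I`, which `τ` sends into `mI`.
      have : ∀ y ∈ koszulSyzygies φ, ∀ a, μ a = y → τ a ∈ maximalIdeal A * I := by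
        intro y hy
        have hdiff : ∀ a b, μ a = μ b → τ (a - b) ∈ maximalIdeal A * I := by
          intro a b hab
          rw [hτ, Fintype.linearCombination_apply]
          refine Ideal.sum_mem _ fun i _ => ?_
          rw [smul_eq_mul, mul_comm ((a - b) i)]
          refine Ideal.mul_mem_mul (hm ▸ Ideal.subset_span (List.mem_ofFn.2 ⟨i, rfl⟩)) ?_
          have := congr_fun hab i
          rw [hμ, hμ] at this
          change π (a i - b i) = 0
          rw [map_sub, this, sub_self]
        suffices ∃ b, μ b = y ∧ τ b ∈ maximalIdeal A * I by
          obtain ⟨b, rfl, hb⟩ := this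
          intro a ha
          rw [← sub_add_cancel a b, map_add]
          exact add_mem (hdiff a b ha) hb
        induction hy using Submodule.span_induction with
        | mem y hy =>
          obtain ⟨a, b, rfl⟩ := hy
          obtain ⟨a, rfl⟩ := hμs a
          obtain ⟨b, rfl⟩ := hμs b
          refine ⟨τ a • b - τ b • a, ?_, ?_⟩
          · rw [hφμ, hφμ, map_sub, map_smul, map_smul]
            simp only [← hπ', algebraMap_smul]
          · rw [map_sub, map_smul, map_smul, smul_eq_mul, smul_eq_mul, mul_comm (τ a), sub_self]
            exact zero_mem _
        | zero => exact ⟨0, map_zero _, by rw [map_zero]; exact zero_mem _⟩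
        | add y z _ _ hy hz =>
          obtain ⟨b, rfl, hb⟩ := hy
          obtain ⟨c, rfl, hc⟩ := hz
          exact ⟨b + c, map_add _ _ _, by rw [map_add]; exact add_mem hb hc⟩
        | smul r y _ hy =>
          obtain ⟨b, rfl, hb⟩ := hy
          obtain ⟨r, rfl⟩ := hπ r
          refine ⟨r • b, ?_, by rw [map_smul]; exact Ideal.mul_mem_left _ _ hb⟩
          rw [map_smul, ← hπ', algebraMap_smul]
      exact this _ ha a rfl
    · intro ha
      -- Subtracting such a `b` leaves a relation on `t` itself, which is trivial because `t` is
      -- regular.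
      obtain ⟨b, hb, hba⟩ : ∃ b : Fin d → A, μ b = 0 ∧ τ b = τ a := by
        change τ a ∈ maximalIdeal A * I at ha
        generalize τ a = z at ha ⊢
        induction ha using Submodule.mul_induction_on' with
        | mem_mul_mem x hx y hy =>
          obtain ⟨c, rfl⟩ := hrange.ge hx
          refine ⟨y • c, ?_, by rw [map_smul, smul_eq_mul, mul_comm]⟩
          ext i
          rw [hμ, Pi.smul_apply, smul_eq_mul, map_mul, show π y = 0 from hy, zero_mul]
          rfl
        | add x _ y _ hx hy =>
          obtain ⟨b, hb, rfl⟩ := hx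
          obtain ⟨c, hc, rfl⟩ := hy
          exact ⟨b + c, by rw [map_add, hb, hc, add_zero], map_add _ _ _⟩
      have h1 : a - b ∈ koszulSyzygies τ :=
        ker_linearCombination_le_koszulSyzygies ht (by
          rw [LinearMap.mem_ker, map_sub, hba, sub_self])
      have h2 : koszulSyzygies τ ≤ ((koszulSyzygies φ).restrictScalars A).comap μ := by
        refine Submodule.span_le.2 ?_
        rintro _ ⟨x, y, rfl⟩
        change μ _ ∈ koszulSyzygies φ
        have := smul_sub_smul_mem_koszulSyzygies φ (μ x) (μ y)
        rw [hφμ, hφμ] at this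
        rw [map_sub, map_smul, map_smul]
        simpa only [← hπ', algebraMap_smul] using this
      have h3 := h2 h1
      change μ (a - b) ∈ koszulSyzygies φ at h3
      rwa [map_sub, hb, sub_zero] at h3
  rw [← Module.length_eq_of_surjective (S := A) hπ,
    ← (LinearMap.quotKerEquivOfSurjective ρ hρs).length_eq,
    (Submodule.quotEquivOfEq _ _ hker).length_eq,
    (LinearMap.quotKerEquivOfSurjective σ hσs).length_eq,
    spanFinrank_eq_finrank_quotient _ (IsNoetherian.noetherian _)]
  let : Module (A ⧸ maximalIdeal A) (I ⧸ (maximalIdeal A • ⊤ : Submodule A I)) := inferInstance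
  have : IsScalarTower A (A ⧸ maximalIdeal A) (I ⧸ (maximalIdeal A • ⊤ : Submodule A I)) :=
    inferInstance
  rw [Module.length_eq_of_surjective (S := A) (R := A ⧸ maximalIdeal A)
    (Ideal.Quotient.mk_surjective)]
  let : Field (A ⧸ maximalIdeal A) := Ideal.Quotient.field _
  exact Module.length_eq_finrank _ _

lemma spanFinrank_ker_add_spanFinrank_maximalIdeal {A B : Type u} {R : Type*} [CommRing A]
    [IsRegularLocalRing A] [CommRing B] [IsRegularLocalRing B] [CommRing R] [IsLocalRing R]
    {π : A →+* R} (hπ : Function.Surjective π) {ρ : B →+* R} (hρ : Function.Surjective ρ) :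
    (RingHom.ker π).spanFinrank + (maximalIdeal B).spanFinrank =
      (RingHom.ker ρ).spanFinrank + (maximalIdeal A).spanFinrank := by
  have hrange : ∀ {A : Type u} [CommRing A] [IsLocalRing A] {π : A →+* R}
      (_ : Function.Surjective π) (l : List A) (_ : Ideal.ofList l = maximalIdeal A),
      LinearMap.range (Fintype.linearCombination R fun i => π (l.get i)) = maximalIdeal R := by
    intro A _ _ π hπ l hl
    rw [Fintype.range_linearCombination, ← map_maximalIdeal_of_surjective π hπ, ← hl,
      Ideal.map_ofList, Ideal.ofList, Ideal.span]
    congr 1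
    ext x
    constructor
    · rintro ⟨y, rfl⟩
      exact List.mem_map.2 ⟨_, List.get_mem l y, rfl⟩
    · intro h
      obtain ⟨a, ha, rfl⟩ := List.mem_map.1 h
      obtain ⟨n, rfl⟩ := List.mem_iff_get.1 ha
      exact ⟨n, rfl⟩
  obtain ⟨ts, htl, htm, ht⟩ := IsRegularLocalRing.exists_isRegular_ofList_eq_maximalIdeal A
  obtain ⟨ss, hsl, hsm, hs⟩ := IsRegularLocalRing.exists_isRegular_ofList_eq_maximalIdeal B
  have h := length_koszulH1_add_eq (hrange hπ ts htm) (hrange hρ ss hsm)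
  rw [length_koszulH1_eq_spanFinrank_ker hπ (t := ts.get)
      (by rw [List.ofFn_get]; exact ht.toIsWeaklyRegular) (by rw [List.ofFn_get]; exact htm),
    length_koszulH1_eq_spanFinrank_ker hρ (t := ss.get)
      (by rw [List.ofFn_get]; exact hs.toIsWeaklyRegular) (by rw [List.ofFn_get]; exact hsm),
    htl, hsl] at h
  have h1 : Module.length R (R ⧸ maximalIdeal R) = 1 :=
    
    Module.length_eq_one_iff.2 (isSimpleModule_iff_isCoatom.2 (maximalIdeal.isMaximal R).out)
  rw [h1, mul_one, mul_one] at h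
  exact_mod_cast h

end Koszul

end

/-! ### Power series rings: regularity, completeness, ramification. -/

section
open RingTheory.Sequence

section PowerSeries
open PowerSeries

variable {A : Type*} [CommRing A] [IsLocalRing A]

lemma PowerSeries.mem_maximalIdeal_iff {u : PowerSeries A} :
    u ∈ maximalIdeal (PowerSeries A) ↔ constantCoeff u ∈ maximalIdeal A := by
  rw [mem_maximalIdeal, mem_maximalIdeal, mem_nonunits_iff, mem_nonunits_iff, isUnit_iff_constantCoeff]

/-- The maximal ideal is generated by that of `A` and `X`, so a factor `X^j` accounts for `j` of the
`k` factors. Truncated subtraction leaves no condition on coefficients with `j ≥ k`. -/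
lemma PowerSeries.mem_maximalIdeal_pow_iff {k : ℕ} {u : PowerSeries A} :
    u ∈ maximalIdeal (PowerSeries A) ^ k ↔ ∀ j, coeff j u ∈ maximalIdeal A ^ (k - j) := by
  constructor
  · intro hu
    induction k generalizing u with
    | zero => simp
    | succ k ih =>
      rw [pow_succ'] at hu
      induction hu using Submodule.mul_induction_on' with
      | mem_mul_mem x hx y hy =>
        intro j
        rw [coeff_mul]
        refine Ideal.sum_mem _ fun ab hab => ?_
        obtain ⟨a, b⟩ := ab
        have hab : a + b = j := by simpa using hab
        have hb := ih hy b
        rcases Nat.eq_zero_or_pos a with rfl | ha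
        · have h0 : coeff 0 x ∈ maximalIdeal A := by
            rw [coeff_zero_eq_constantCoeff_apply]
            exact mem_maximalIdeal_iff.1 hx
          refine Ideal.pow_le_pow_right (show k + 1 - j ≤ 1 + (k - b) by omega) ?_
          rw [pow_add, pow_one]
          exact Ideal.mul_mem_mul h0 hb
        · exact Ideal.mul_mem_left _ _ (Ideal.pow_le_pow_right (by omega) hb)
      | add x _ y _ hx hy =>
        intro j
        rw [map_add]
        exact add_mem (hx j) (hy j)
  · intro hu
    have hC : ∀ k, ∀ a ∈ maximalIdeal A ^ k, C a ∈ maximalIdeal (PowerSeries A) ^ k := by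
      intro k a ha
      have hle : (maximalIdeal A).map (C (R := A)) ≤ maximalIdeal (PowerSeries A) :=
        Ideal.map_le_iff_le_comap.2 fun a ha => mem_maximalIdeal_iff.2 (by simpa using ha)
      refine Ideal.pow_right_mono hle k ?_
      rw [← Ideal.map_pow]
      exact Ideal.mem_map_of_mem _ ha
    induction k generalizing u with
    | zero => simp
    | succ k ih =>
      rw [eq_X_mul_shift_add_const u]
      refine add_mem ?_ (hC _ _ ?_)
      · rw [pow_succ']
        refine Ideal.mul_mem_mul (mem_maximalIdeal_iff.2 (by simp)) (ih fun j => ?_)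
        rw [coeff_mk]
        have := hu (j + 1)
        rwa [Nat.add_sub_add_right] at this
      · simpa using hu 0

/-- Limits are taken coefficientwise. The coefficient of index `j` is Cauchy only with a delay of
`j`, hence the reindexing `f (k + j)`. -/
lemma PowerSeries.isPrecomplete_maximalIdeal [IsPrecomplete (maximalIdeal A) A] :
    IsPrecomplete (maximalIdeal (PowerSeries A)) (PowerSeries A) := by
  refine ⟨fun f hf => ?_⟩
  have hf' : ∀ {m n : ℕ}, m ≤ n → ∀ j, coeff j (f m) - coeff j (f n) ∈ maximalIdeal A ^ (m - j) := by
    intro m n hmn j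
    have h := hf hmn
    rw [SModEq.sub_mem, smul_eq_mul, Ideal.mul_top, mem_maximalIdeal_pow_iff] at h
    rw [← map_sub]
    exact h j
  have hL : ∀ j, ∃ L : A, ∀ k, coeff j (f (k + j)) - L ∈ maximalIdeal A ^ k := by
    intro j
    obtain ⟨L, hL⟩ := IsPrecomplete.prec (I := maximalIdeal A) (M := A) inferInstance
      (f := fun k => coeff j (f (k + j))) (fun {m n} hmn => by
        rw [SModEq.sub_mem, smul_eq_mul, Ideal.mul_top]
        have := hf' (Nat.add_le_add_right hmn j) j
        rwa [Nat.add_sub_cancel] at this)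
    refine ⟨L, fun k => ?_⟩
    have := hL k
    rwa [SModEq.sub_mem, smul_eq_mul, Ideal.mul_top] at this
  choose L hL using hL
  refine ⟨mk L, fun n => ?_⟩
  rw [SModEq.sub_mem, smul_eq_mul, Ideal.mul_top, mem_maximalIdeal_pow_iff]
  intro j
  rw [map_sub, coeff_mk]
  rcases le_or_gt j n with hj | hj
  · have := hL j (n - j)
    rwa [Nat.sub_add_cancel hj] at this
  · rw [Nat.sub_eq_zero_of_le hj.le]
    simp

/-- Adjoining `X` raises the dimension by at least one and the number of generators by at most one.
-/
lemma IsRegularLocalRing.powerSeries {A : Type*} [CommRing A] [IsRegularLocalRing A] :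
    IsRegularLocalRing (PowerSeries A) ∧
      (maximalIdeal (PowerSeries A)).spanFinrank = (maximalIdeal A).spanFinrank + 1 := by
  have h1 : ringKrullDim A + 1 ≤ ringKrullDim (PowerSeries A) :=
    ringKrullDim_succ_le_ringKrullDim_powerseries
  have h2 : (maximalIdeal (PowerSeries A)).spanFinrank ≤ (maximalIdeal A).spanFinrank + 1 := by
    have := spanFinrank_le_spanFinrank_map_constantCoeff_add_one_of_X_mem
      (I := maximalIdeal (PowerSeries A)) (PowerSeries.mem_maximalIdeal_iff.2 (by simp))
    rwa [map_maximalIdeal_of_surjective _ constantCoeff_surj] at this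
  rw [← IsRegularLocalRing.spanFinrank_maximalIdeal] at h1
  have h3 := IsRegularLocalRing.of_spanFinrank_maximalIdeal_le (PowerSeries A)
    (le_trans (by exact_mod_cast h2) h1)
  refine ⟨h3, le_antisymm h2 ?_⟩
  rw [← h3.spanFinrank_maximalIdeal] at h1
  exact_mod_cast h1

lemma isPrecomplete_maximalIdeal_of_ringEquiv {A B : Type*} [CommRing A] [CommRing B]
    [IsLocalRing A] [IsLocalRing B] (e : A ≃+* B) [h : IsPrecomplete (maximalIdeal A) A] :
    IsPrecomplete (maximalIdeal B) B := by
  rw [← IsPrecomplete.congr_ringEquiv (maximalIdeal A) e] at h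
  rwa [← map_ringEquiv_maximalIdeal e]

lemma spanFinrank_maximalIdeal_of_ringEquiv {A B : Type*} [CommRing A] [CommRing B]
    [IsRegularLocalRing A] [IsRegularLocalRing B] (e : A ≃+* B) :
    (maximalIdeal B).spanFinrank = (maximalIdeal A).spanFinrank := by
  have h := ringKrullDim_eq_of_ringEquiv e
  rw [← IsRegularLocalRing.spanFinrank_maximalIdeal,
    ← IsRegularLocalRing.spanFinrank_maximalIdeal] at h
  exact_mod_cast h.symm

lemma MvPowerSeries.isRegularLocalRing_and_isPrecomplete (A : Type*) [CommRing A]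
    [IsRegularLocalRing A] [IsPrecomplete (maximalIdeal A) A] (n : ℕ) :
    IsRegularLocalRing (MvPowerSeries (Fin n) A) ∧
      (maximalIdeal (MvPowerSeries (Fin n) A)).spanFinrank = (maximalIdeal A).spanFinrank + n ∧
      IsPrecomplete (maximalIdeal (MvPowerSeries (Fin n) A)) (MvPowerSeries (Fin n) A) := by
  induction n with
  | zero =>
    let e := (MvPowerSeries.isEmptyEquiv (Fin 0) A).toRingEquiv.symm
    have h := IsRegularLocalRing.of_ringEquiv e
    exact ⟨h, spanFinrank_maximalIdeal_of_ringEquiv e, isPrecomplete_maximalIdeal_of_ringEquiv e⟩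
  | succ n ih =>
    obtain ⟨h1, h2, h3⟩ := ih
    let e := (MvPowerSeries.finSuccEquiv A n).toRingEquiv.symm
    obtain ⟨h4, h5⟩ := IsRegularLocalRing.powerSeries (A := MvPowerSeries (Fin n) A)
    have h6 := PowerSeries.isPrecomplete_maximalIdeal (A := MvPowerSeries (Fin n) A)
    have h := IsRegularLocalRing.of_ringEquiv e
    refine ⟨h, ?_, isPrecomplete_maximalIdeal_of_ringEquiv e⟩
    rw [spanFinrank_maximalIdeal_of_ringEquiv e, h5, h2]
    rfl

end PowerSeries

/-- Limits descend along a surjection, and a Noetherian local ring is separated, so `R` is its own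
completion. A presentation of the completion thus becomes one of `R`. -/
lemma AdicCompletion.algebraMap_bijective_of_surjective {S R : Type u} [CommRing S] [IsLocalRing S]
    [IsPrecomplete (maximalIdeal S) S] [CommRing R] [IsLocalRing R] [IsNoetherianRing R]
    {π : S →+* R} (hπ : Function.Surjective π) :
    Function.Bijective (algebraMap R (AdicCompletion (maximalIdeal R) R)) := by
  algebraize [π]
  have h1 : IsPrecomplete (maximalIdeal S) R := by
    rw [← AdicCompletion.of_surjective_iff]
    intro y
    obtain ⟨z, rfl⟩ := AdicCompletion.map_surjective (maximalIdeal S)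
      (f := Algebra.linearMap S R) hπ y
    obtain ⟨x, rfl⟩ := AdicCompletion.of_surjective (maximalIdeal S) S z
    exact ⟨Algebra.linearMap S R x, (AdicCompletion.map_of _ _ _).symm⟩
  have h2 : IsPrecomplete (maximalIdeal R) R := by
    rw [← map_maximalIdeal_of_surjective π hπ]
    exact IsPrecomplete.map_algebraMap_iff.2 h1
  exact AdicCompletion.of_bijective_iff.2 {}

/-- Taking constant coefficients would give `p ∈ (p²)` in `V`, making `p` a unit. -/
lemma natCast_notMem_maximalIdeal_sq_mvPowerSeries {p : ℕ} {V : Type*} [CommRing V] [IsDomain V]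
    [IsLocalRing V] [CharZero V] (hp : p ≠ 0) (hV : maximalIdeal V = Ideal.span {(p : V)})
    (σ : Type*) : (p : MvPowerSeries σ V) ∉ maximalIdeal (MvPowerSeries σ V) ^ 2 := by
  intro h
  have hs : Function.Surjective (MvPowerSeries.constantCoeff (σ := σ) (R := V)) := fun a =>
    ⟨MvPowerSeries.C a, by simp⟩
  have h1 := Ideal.mem_map_of_mem (MvPowerSeries.constantCoeff (σ := σ) (R := V)) h
  rw [Ideal.map_pow, map_maximalIdeal_of_surjective _ hs, map_natCast, hV,
    Ideal.span_singleton_pow, Ideal.mem_span_singleton'] at h1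
  obtain ⟨c, hc⟩ := h1
  have hp0 : (p : V) ≠ 0 := Nat.cast_ne_zero.2 hp
  have h2 : c * (p : V) = 1 := mul_right_cancel₀ hp0 (by rw [one_mul, mul_assoc, ← pow_two, hc])
  have h3 : (p : V) ∈ maximalIdeal V := hV ▸ Ideal.mem_span_singleton_self _
  exact h3 (IsUnit.of_mul_eq_one_right c h2)

lemma isUnramifiedRegularLocalRing_mvPowerSeries {p : ℕ} (hp : p.Prime) (V : Type u) [CommRing V]
    [IsRegularLocalRing V] [CharZero V]
    (hV : maximalIdeal V = Ideal.span {(p : V)}) [IsPrecomplete (maximalIdeal V) V] (n : ℕ) :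
    IsUnramifiedRegularLocalRing p (MvPowerSeries (Fin n) V) where
  regular := (MvPowerSeries.isRegularLocalRing_and_isPrecomplete V n).1
  prime := hp
  charZero := charZero_of_injective_ringHom
    (f := MvPowerSeries.C (σ := Fin n) (R := V)) MvPowerSeries.C_injective
  residueChar := by
    have hs : Function.Surjective (MvPowerSeries.constantCoeff (σ := Fin n) (R := V)) := fun a =>
      ⟨MvPowerSeries.C a, by simp⟩
    have h : (p : MvPowerSeries (Fin n) V) ∈ maximalIdeal (MvPowerSeries (Fin n) V) := by
      intro hu
      have h1 := hu.map (MvPowerSeries.constantCoeff (σ := Fin n) (R := V))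
      rw [map_natCast] at h1
      exact (hV ▸ Ideal.mem_span_singleton_self _ : (p : V) ∈ maximalIdeal V) h1
    have h2 : (p : ResidueField (MvPowerSeries (Fin n) V)) = 0 := by
      rw [← map_natCast (residue (MvPowerSeries (Fin n) V))]
      exact (residue_eq_zero_iff _).2 h
    exact (CharP.ringChar_of_prime_eq_zero hp h2) ▸ inferInstance
  natCast_notMem_sq := natCast_notMem_maximalIdeal_sq_mvPowerSeries hp.ne_zero hV _

end

/-! ### Every presentation has a complete intersection kernel; the Lyubeznik numbers. -/

section
open RingTheory.Sequence

/-- The kernel of a surjection of a regular local ring `T` onto the quotient of a regular local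
ring by a regular sequence is generated by a regular sequence, whose length is determined by
the dimensions. -/
lemma exists_isRegular_ofList_eq_ker {S T R : Type u} [CommRing S] [IsRegularLocalRing S]
    [CommRing T] [IsRegularLocalRing T] [CommRing R] [IsLocalRing R]
    {ρ : S →+* R} (hρ : Function.Surjective ρ) {π : T →+* R} (hπ : Function.Surjective π)
    {fs : List S} (hfs : IsRegular S fs) (hker : Ideal.ofList fs = RingHom.ker ρ) :
    ∃ gs : List T, gs.length + (maximalIdeal S).spanFinrank =
        fs.length + (maximalIdeal T).spanFinrank ∧
      fs.length ≤ (maximalIdeal S).spanFinrank ∧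
      Ideal.ofList gs = RingHom.ker π ∧ IsRegular T gs := by
  have hS := IsRegularLocalRing.spanFinrank_maximalIdeal (R := S)
  have hT := IsRegularLocalRing.spanFinrank_maximalIdeal (R := T)
  have hdimS := ringKrullDim_add_length_eq_ringKrullDim_of_isRegular fs hfs
  have hnoeth : IsNoetherianRing R := isNoetherianRing_of_surjective _ _ ρ hρ
  rw [hker, ringKrullDim_eq_of_ringEquiv (RingHom.quotientKerEquivOfSurjective hρ), ← hS] at hdimS
  obtain ⟨c, hc⟩ : ∃ c : ℕ, ringKrullDim R = c :=
    ⟨_, (WithBot.coe_unbot _ ringKrullDim_ne_bot).symm.trans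
      (congrArg _ (ENat.natCast_toNat
        (by simpa [WithBot.unbot_eq_iff] using ringKrullDim_ne_top)).symm)⟩
  rw [hc] at hdimS
  norm_cast at hdimS
  -- No shorter list generates the kernel, because its quotient has dimension lower by `fs.length`.
  have hl : (RingHom.ker ρ).spanFinrank = fs.length := by
    refine le_antisymm (hker ▸ Ideal.spanFinrank_ofList_le fs) ?_
    have h := ringKrullDim_le_ringKrullDim_quotient_add_spanFinrank (I := RingHom.ker ρ)
      (by rw [IsLocalRing.ringJacobson_eq_maximalIdeal]
          exact le_maximalIdeal (RingHom.ker_ne_top ρ))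
    rw [ringKrullDim_eq_of_ringEquiv (RingHom.quotientKerEquivOfSurjective hρ), hc, ← hS] at h
    norm_cast at h
    omega
  have hlen := spanFinrank_ker_add_spanFinrank_maximalIdeal hπ hρ
  obtain ⟨gs, hgl, hgs⟩ := Ideal.exists_ofList_eq_of_fg (IsNoetherian.noetherian (RingHom.ker π))
  refine ⟨gs, by omega, by omega, hgs, ?_⟩
  -- The invariance of `μ(I) - dim T` makes the length of `gs` equal to the drop in dimension.
  refine IsRegularLocalRing.isRegular_of_ringKrullDim_add_length_eq (fun g hg => ?_) ?_
  · exact le_maximalIdeal (RingHom.ker_ne_top π) (hgs ▸ Ideal.subset_span hg)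
  · rw [hgs, ringKrullDim_eq_of_ringEquiv (RingHom.quotientKerEquivOfSurjective hπ), hc, ← hT]
    norm_cast
    omega

lemma UnramifiedPresentation.number_eq {p : ℕ} {S R : Type u} [CommRing S] [IsRegularLocalRing S]
    [CommRing R] [IsLocalRing R]
    (hcomplete : Function.Bijective (algebraMap R (AdicCompletion (maximalIdeal R) R)))
    {ρ : S →+* R} (hρ : Function.Surjective ρ) {fs : List S} (hfs : IsRegular S fs)
    (hker : Ideal.ofList fs = RingHom.ker ρ) (P : UnramifiedPresentation p R) (i j : ℕ) :
    P.number i j = if i + fs.length = (maximalIdeal S).spanFinrank ∧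
      j + fs.length = (maximalIdeal S).spanFinrank then 1 else 0 := by
  have hT := P.unramified.regular
  let e := RingEquiv.ofBijective _ hcomplete
  let π : P.T →+* R := e.symm.toRingHom.comp P.π
  have hπ : Function.Surjective π := e.symm.surjective.comp P.surjective
  have hkerπ : RingHom.ker π = RingHom.ker P.π := by
    ext x
    rw [RingHom.mem_ker, RingHom.mem_ker]
    exact map_eq_zero_iff e.symm e.symm.injective
  obtain ⟨gs, hlen, hle, hgs, hreg⟩ := exists_isRegular_ofList_eq_ker hρ hπ hfs hker
  obtain ⟨ts, htl, htm, hts⟩ := IsRegularLocalRing.exists_isRegular_ofList_eq_maximalIdeal P.T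
  have hd : (maximalIdeal P.T).spanFinrank = P.dim := by
    have h := IsRegularLocalRing.spanFinrank_maximalIdeal (R := P.T)
    rw [P.ringKrullDim_eq] at h
    exact_mod_cast h
  rw [UnramifiedPresentation.number, extLocalCohomologyDim, ← hkerπ, ← hgs]
  -- When `j > dim T` the number is zero by convention; this is consistent because `j = dim S - l`
  -- would give `j = dim T - gs.length ≤ dim T`.
  split_ifs with h1 h2 h2
  · rw [rank_extResidue_localCohomology hreg hts htm, if_pos (by omega)]
  · rw [rank_extResidue_localCohomology hreg hts htm, if_neg (by omega)]
  · omega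
  · rfl

end

theorem proposition3p11 (p : ℕ) (hp : p.Prime)
    (V : Type u) [CommRing V] [IsDomain V] [IsDiscreteValuationRing V] [CharZero V]
    (hV : maximalIdeal V = Ideal.span {(p : V)}) [IsAdicComplete (maximalIdeal V) V]
    (n l : ℕ) (f : Fin l → MvPowerSeries (Fin n) V)
    (hf : RingTheory.Sequence.IsRegular (MvPowerSeries (Fin n) V) (List.ofFn f)) :
    haveI : IsLocalRing (MvPowerSeries (Fin n) V ⧸ Ideal.span (Set.range f)) :=
      isLocalRing_quotient_of_isRegular hf
    ∀ i j : ℕ, HasLyubeznikNumber p (MvPowerSeries (Fin n) V ⧸ Ideal.span (Set.range f)) i j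
      (if i + l = n + 1 ∧ j + l = n + 1 then 1 else 0) := by
  have : IsLocalRing (MvPowerSeries (Fin n) V ⧸ Ideal.span (Set.range f)) :=
    isLocalRing_quotient_of_isRegular hf
  obtain ⟨hS, hdim, hcomp⟩ := MvPowerSeries.isRegularLocalRing_and_isPrecomplete V n
  have hV1 : (maximalIdeal V).spanFinrank = 1 := by
    have h := IsRegularLocalRing.spanFinrank_maximalIdeal (R := V)
    rw [IsPrincipalIdealRing.ringKrullDim_eq_one V (IsDiscreteValuationRing.not_isField V)] at h
    exact_mod_cast h
  rw [hV1, add_comm] at hdim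
  have hmk := Ideal.Quotient.mk_surjective (I := Ideal.span (Set.range f))
  have hbij := AdicCompletion.algebraMap_bijective_of_surjective hmk
  have hker : Ideal.ofList (List.ofFn f) =
      RingHom.ker (Ideal.Quotient.mk (Ideal.span (Set.range f))) := by
    rw [Ideal.mk_ker]
    simp only [Ideal.ofList, List.mem_ofFn]
    rfl
  intro i j
  -- The power series ring itself provides the required presentation.
  refine ⟨⟨{
    T := MvPowerSeries (Fin n) V
    unramified := isUnramifiedRegularLocalRing_mvPowerSeries hp V hV n
    dim := n + 1
    ringKrullDim_eq := by rw [← IsRegularLocalRing.spanFinrank_maximalIdeal, hdim]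
    π := (algebraMap _ _).comp (Ideal.Quotient.mk (Ideal.span (Set.range f)))
    surjective := hbij.2.comp hmk }⟩, fun P => ?_⟩
  rw [P.number_eq hbij hmk hf hker, hdim, List.length_ofFn]
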